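/- \textbf{Framework.} Let $\mathit{Intv}$ be the set of intervals of $\mathbb{R}_+$ with endpoints in $\mathbb{N}\cup\{\infty\}$. A \emph{state variable} $x=(V_x,T_x,D_x)$ consists of a finite set $V_x$ of values, a transition function $T_x:V_x\to 2^{V_x}$ and a constraint function $D_x:V_x\to\mathit{Intv}$. A \emph{timeline} for $x$ is a finite non-empty sequence of tokens $(v_0,d_0)\cdots(v_n,d_n)$ with $d_i\in D_x(v_i)$ and $v_{i+1}\in T_x(v_i)$; its $i$-th token has start time $\mathsf{s}=\sum_{h<i}d_h$ and end time $\mathsf{e}=\sum_{h\le i}d_h$. A \emph{multi-timeline} of a finite set $SV$ of state variables assigns to each $x\in SV$ a timeline for $x$. An \emph{atom} is an interval atom $o_1\leq^{e_1,e_2}_I o_2$ (meaning $e_2(o_2)-e_1(o_1)\in I$) or a time-point atom $o\leq^{e}_I n$ (meaning $n-e(o)\in I$) or $n\leq^{e}_I o$ (meaning $e(o)-n\in I$), where $o,o_1,o_2$ are token names, $I\in\mathit{Intv}$, $n\in\mathbb{N}$ and $e,e_1,e_2\in\{\mathsf{s},\mathsf{e}\}$. An \emph{existential statement} is $\exists o_1[x_1=v_1]\cdots\exists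 o_k[x_k=v_k].\,\mathcal{C}$ with $\mathcal{C}$ a conjunction of atoms; it is satisfied by an assignment of tokens to token names if each $o_i$ denotes a token of value $v_i$ of the timeline for $x_i$ and all the atoms of $\mathcal{C}$ hold. A \emph{trigger rule} $o_0[x_0=v_0]\to\mathcal{E}_1\vee\dots\vee\mathcal{E}_k$ (in which only $o_0$ may be free) requires that for every token of value $v_0$ of the timeline for $x_0$ some $\mathcal{E}_i$ is satisfied by an assignment mapping $o_0$ to that token; under the \emph{future semantics} each $\mathcal{E}_i$ is first strengthened by the atoms $o_0\leq^{\mathsf{s},\mathsf{s}}_{[0,+\infty[}o$ for all its quantified names $o$. A \emph{trigger-less rule} $\top\to\mathcal{E}_1\vee\dots\vee\mathcal{E}_k$ (without free names) requires that some $\mathcal{E}_i$ is satisfied. A trigger rule is \emph{simple} if in each of its existential statements every token name other than the trigger occurs in at most one interval atom. The \emph{future TP problem} asks, given a finite set $SV$ of state variables and a finite set $R$ of synchronization rules (numbers being written in binary), whether there is a multi-timeline of $SV$ that satisfies all the trigger-less rules of $R$, and all the trigger rules of $R$ under the future semantics. Let $\mathit{Intv}_{(0,\infty)}$ be the set of the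 intervals that are unbounded or left-closed with left endpoint $0$. \textbf{Theorem.} The future TP problem with simple trigger rules, restricted to instances in which every interval occurring in an atom of a rule (trigger or trigger-less) is of the form $[0,a]$ with $a\in\mathbb{N}\setminus\{0\}$, and every value of a constraint function is of the form $[0,a]$ with $a\in\mathbb{N}\setminus\{0\}$ or $[b,+\infty[$ with $b\in\mathbb{N}$, is PSPACE-hard under polynomial-time many-one reductions. This holds even when the instances are further restricted to a single state variable. In particular, the future TP problem with simple trigger rules and intervals in the atoms of the trigger rules belonging to $\mathit{Intv}_{(0,\infty)}$ is PSPACE-hard. -/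

import Mathlib

open scoped NNReal

namespace TP

/-! ## Complexity: polynomial space and polynomial-time reductions

The machine model is the one of Mathlib (`Turing.FinTM2`): finitely many stacks, finite control,
the input is given on one stack and the output is left on another one. -/

/-- The space occupied by a configuration: the total height of all the stacks. -/
def space (tm : Turing.FinTM2) (c : tm.Cfg) : ℕ :=
  letI := tm.kFin
  ∑ k : tm.K, (Turing.TM2.Cfg.stk c k).length

open Classical in
/-- `L` is decided by a deterministic machine in polynomial space: on every input `w` all the
configurations that are reached have size at most `p(|w|)`, and the machine halts with a single
bit as output, namely the answer to `w ∈ L`. -/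
def InPSPACE (L : Set (List Bool)) : Prop :=
  ∃ (M : Turing.TM2ComputableAux Bool Bool) (p : Polynomial ℕ), ∀ w : List Bool,
    (∀ c, StateTransition.Reaches M.tm.step
        (Turing.initList M.tm (w.map M.inputAlphabet.symm)) c →
      space M.tm c ≤ p.eval w.length) ∧
    Nonempty (Turing.TM2Outputs M.tm (w.map M.inputAlphabet.symm)
      (some [M.outputAlphabet.symm (decide (w ∈ L))]))

/-- The decision problem "given `a ∈ inst`, does `a ∈ yes` hold?", with instances written as
strings by `enc`, is PSPACE-hard under polynomial-time many-one reductions: every language in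
PSPACE is reduced to it by a polynomial-time computable `f` all of whose values are in `inst`. -/
def PSPACEHard {α Γ : Type} [Fintype Γ] (enc : Computability.Encoding α Γ)
    (inst yes : Set α) : Prop :=
  ∀ L : Set (List Bool), InPSPACE L →
    ∃ f : List Bool → α,
      Nonempty (Turing.TM2ComputableInPolyTime
        (Computability.encodingList Bool).encode enc.encode f) ∧
      (∀ w, f w ∈ inst) ∧ ∀ w, w ∈ L ↔ f w ∈ yes

/-! ## Timeline-based planning: the objects -/

/-- An interval of `ℝ₊` with endpoints in `ℕ ∪ {∞}`; `hi = none` means that it is unbounded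
(and then `hiClosed` is irrelevant). -/
structure Intv where
  lo : ℕ
  loClosed : Bool
  hi : Option ℕ
  hiClosed : Bool

namespace Intv

/-- The set of reals denoted by an interval; all its elements are nonnegative. -/
def toSet (I : Intv) : Set ℝ :=
  {t | (if I.loClosed then (I.lo : ℝ) ≤ t else (I.lo : ℝ) < t) ∧
    ∀ h ∈ I.hi, if I.hiClosed then t ≤ (h : ℝ) else t < (h : ℝ)}

/-- `[0, a]` -/
def zeroTo (a : ℕ) : Intv := ⟨0, true, some a, true⟩

/-- `[b, +∞[` -/
def fromTo (b : ℕ) : Intv := ⟨b, true, none, false⟩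

/-- `I` is unbounded, or left-closed with left endpoint `0`. -/
def IsZeroInfty (I : Intv) : Prop :=
  I.hi = none ∨ (I.loClosed = true ∧ I.lo = 0)

end Intv

/-- A state variable with values `0, …, size - 1`: value transition function (`succs v` lists the
successors of `v`) and constraint function. -/
structure StateVar where
  size : ℕ
  succs : Fin size → List (Fin size)
  dur : Fin size → Intv

/-- The two endpoints of a token: start and end. -/
inductive Endpoint where
  | start
  | finish

/-- Atoms; token names are natural numbers.
`interval o₁ e₁ I e₂ o₂` is `o₁ ≤^{e₁,e₂}_I o₂`, `lePoint o e I n` is `o ≤^e_I n` and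
`pointLe n e I o` is `n ≤^e_I o`. -/
inductive Atom where
  | interval (o₁ : ℕ) (e₁ : Endpoint) (I : Intv) (e₂ : Endpoint) (o₂ : ℕ)
  | lePoint (o : ℕ) (e : Endpoint) (I : Intv) (n : ℕ)
  | pointLe (n : ℕ) (e : Endpoint) (I : Intv) (o : ℕ)

namespace Atom

/-- The token names used in an atom. -/
def names : Atom → List ℕ
  | interval o₁ _ _ _ o₂ => [o₁, o₂]
  | lePoint o _ _ _ => [o]
  | pointLe _ _ _ o => [o]

/-- The token names used in an interval atom; none if the atom is a time-point atom. -/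
def intervalNames : Atom → List ℕ
  | interval o₁ _ _ _ o₂ => [o₁, o₂]
  | lePoint _ _ _ _ => []
  | pointLe _ _ _ _ => []

/-- The interval of an atom. -/
def intv : Atom → Intv
  | interval _ _ I _ _ => I
  | lePoint _ _ I _ => I
  | pointLe _ _ I _ => I

end Atom

/-- A quantifier `o[x = v]`, for a family `X` of state variables. -/
structure Quantifier {m : ℕ} (X : Fin m → StateVar) where
  name : ℕ
  sv : Fin m
  val : Fin (X sv).size

/-- An existential statement `∃ o₁[x₁ = v₁] ⋯ ∃ oₙ[xₙ = vₙ]. 𝒞`, with `𝒞` a conjunction of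
atoms. -/
structure ExStmt {m : ℕ} (X : Fin m → StateVar) where
  quants : List (Quantifier X)
  atoms : List Atom

/-- Synchronization rules: trigger rules `o₀[x₀ = v₀] → ℰ₁ ∨ ⋯ ∨ ℰₖ` and trigger-less rules
`⊤ → ℰ₁ ∨ ⋯ ∨ ℰₖ`. -/
inductive Rule {m : ℕ} (X : Fin m → StateVar) where
  | trigger (t : Quantifier X) (body : List (ExStmt X))
  | triggerless (body : List (ExStmt X))

namespace Rule

variable {m : ℕ} {X : Fin m → StateVar}

/-- The existential statements of a rule. -/
def body : Rule X → List (ExStmt X)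
  | trigger _ b => b
  | triggerless b => b

/-- Only the trigger name may be free in a trigger rule, and no name in a trigger-less rule. -/
def WellFormed : Rule X → Prop
  | trigger t b => ∀ E ∈ b, ∀ a ∈ E.atoms, ∀ o ∈ a.names,
      o = t.name ∨ ∃ q ∈ E.quants, q.name = o
  | triggerless b => ∀ E ∈ b, ∀ a ∈ E.atoms, ∀ o ∈ a.names, ∃ q ∈ E.quants, q.name = o

/-- The rule is trigger-less, or it is a simple trigger rule: for each of its existential
statements and each token name `o` other than the trigger, `o` occurs in at most one interval
atom. -/
def SimpleIfTrigger : Rule X → Prop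
  | trigger t b => ∀ E ∈ b, ∀ o : ℕ, o ≠ t.name →
      E.atoms.countP (fun a => decide (o ∈ a.intervalNames)) ≤ 1
  | triggerless _ => True

/-- The rule is a trigger rule. -/
def IsTrigger : Rule X → Prop
  | trigger _ _ => True
  | triggerless _ => False

/-- The future semantics of trigger rules, as a transformation of rules: the atoms
`o₀ ≤^{s,s}_{[0,+∞[} oᵢ` are added to each existential statement of a trigger rule. -/
def future : Rule X → Rule X
  | trigger t b => trigger t (b.map fun E =>
      ⟨E.quants, E.atoms ++ E.quants.map fun q =>
        Atom.interval t.name .start (Intv.fromTo 0) .start q.name⟩)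
  | triggerless b => triggerless b

end Rule

/-- A TP domain `(SV, R)` as it is presented to an algorithm: finitely many state variables and
finitely many rules. -/
structure Domain where
  numVars : ℕ
  var : Fin numVars → StateVar
  rules : List (Rule var)

/-! ## Semantics -/

/-- A timeline for `x`: a nonempty sequence of tokens (value, duration), consistent with the
constraint function and with the value transition function. -/
structure Timeline (x : StateVar) where
  tokens : List (Fin x.size × ℝ≥0)
  ne_nil : tokens ≠ []
  dur_mem : ∀ tk ∈ tokens, ((tk.2 : ℝ≥0) : ℝ) ∈ (x.dur tk.1).toSet
  chain : ∀ (i : ℕ) (h : i + 1 < tokens.length), tokens[i + 1].1 ∈ x.succs tokens[i].1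

namespace Timeline

/-- The start time, resp. end time, of the `i`-th token. -/
def time {x : StateVar} (π : Timeline x) (i : ℕ) : Endpoint → ℝ
  | .start => (((π.tokens.take i).map Prod.snd).sum : ℝ≥0)
  | .finish => (((π.tokens.take (i + 1)).map Prod.snd).sum : ℝ≥0)

end Timeline

section Semantics

variable {m : ℕ} {X : Fin m → StateVar}

/-- A multi-timeline: a timeline for each state variable. -/
abbrev MultiTimeline (X : Fin m → StateVar) := ∀ x : Fin m, Timeline (X x)

/-- A token of a multi-timeline: a timeline and a position along it. -/
abbrev Token (𝓣 : MultiTimeline X) := (x : Fin m) × Fin (𝓣 x).tokens.length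

/-- The value of a quantifier is taken by the token `tk`, which belongs to the right timeline. -/
def Quantifier.Matches (q : Quantifier X) (𝓣 : MultiTimeline X) (tk : Token 𝓣) : Prop :=
  ∃ i : Fin (𝓣 q.sv).tokens.length, tk = ⟨q.sv, i⟩ ∧ ((𝓣 q.sv).tokens[i]).1 = q.val

/-- Satisfaction of an atom by an assignment of tokens to token names. -/
def Atom.Sat (𝓣 : MultiTimeline X) (asg : ℕ → Token 𝓣) : Atom → Prop
  | .interval o₁ e₁ I e₂ o₂ =>
      (𝓣 (asg o₂).1).time (asg o₂).2 e₂ - (𝓣 (asg o₁).1).time (asg o₁).2 e₁ ∈ I.toSet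
  | .lePoint o e I n => (n : ℝ) - (𝓣 (asg o).1).time (asg o).2 e ∈ I.toSet
  | .pointLe n e I o => (𝓣 (asg o).1).time (asg o).2 e - (n : ℝ) ∈ I.toSet

/-- The assignment is consistent with the existential statement and satisfies its atoms. -/
def ExStmt.SatBy (E : ExStmt X) (𝓣 : MultiTimeline X) (asg : ℕ → Token 𝓣) : Prop :=
  (∀ q ∈ E.quants, q.Matches 𝓣 (asg q.name)) ∧ ∀ a ∈ E.atoms, a.Sat 𝓣 asg

/-- Satisfaction of a synchronization rule (ordinary semantics). -/
def Rule.Sat (𝓣 : MultiTimeline X) : Rule X → Prop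
  | .trigger t b => ∀ i : Fin (𝓣 t.sv).tokens.length, ((𝓣 t.sv).tokens[i]).1 = t.val →
      ∃ E ∈ b, ∃ asg : ℕ → Token 𝓣, asg t.name = ⟨t.sv, i⟩ ∧ E.SatBy 𝓣 asg
  | .triggerless b => ∃ E ∈ b, ∃ asg : ℕ → Token 𝓣, E.SatBy 𝓣 asg

end Semantics

namespace Domain

/-- A future plan of `P`: trigger rules are satisfied under the future semantics. -/
def IsFuturePlan (P : Domain) (𝓣 : MultiTimeline P.var) : Prop :=
  ∀ R ∈ P.rules, R.future.Sat 𝓣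

/-- The positive instances of the future TP problem. -/
def HasFuturePlan (P : Domain) : Prop := ∃ 𝓣 : MultiTimeline P.var, P.IsFuturePlan 𝓣

/-- The rules are well formed and the trigger rules are simple. -/
def IsSimple (P : Domain) : Prop := ∀ R ∈ P.rules, R.WellFormed ∧ R.SimpleIfTrigger

/-- All the atoms of the rules (trigger or trigger-less) have an interval `[0, a]`, `a ≥ 1`. -/
def AtomsZeroTo (P : Domain) : Prop :=
  ∀ R ∈ P.rules, ∀ E ∈ R.body, ∀ a ∈ E.atoms, ∃ n : ℕ, 0 < n ∧ a.intv = Intv.zeroTo n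

/-- The constraint functions of the state variables use only intervals `[0, a]`, `a ≥ 1`, and
`[b, +∞[`. -/
def DurationsZeroToOrFrom (P : Domain) : Prop :=
  ∀ (x : Fin P.numVars) (v : Fin (P.var x).size),
    (∃ n : ℕ, 0 < n ∧ (P.var x).dur v = Intv.zeroTo n) ∨
    ∃ n : ℕ, (P.var x).dur v = Intv.fromTo n

/-- All the atoms of the trigger rules have an interval that is unbounded or left-closed with
left endpoint `0`. -/
def TriggerAtomsZeroInfty (P : Domain) : Prop :=
  ∀ R ∈ P.rules, R.IsTrigger → ∀ E ∈ R.body, ∀ a ∈ E.atoms, a.intv.IsZeroInfty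

end Domain

/-! ## Instances as strings

Numbers are written in binary. The alphabet consists of the two bits, `blank`, `bra`, `ket` and
`comma`. -/

section Encoding

open Computability

/-- Binary digits (least significant first), then a comma. -/
def encNat (n : ℕ) : List Γ' := (encodeNat n).map Γ'.bit ++ [Γ'.comma]

/-- Each element is preceded by `bra`; the list is closed by `ket`. -/
def encList {α : Type} (e : α → List Γ') : List α → List Γ'
  | [] => [Γ'.ket]
  | a :: l => Γ'.bra :: (e a ++ encList e l)

def encHi : Option ℕ → List Γ'
  | none => [Γ'.blank]
  | some n => encNat n

def encIntv (I : Intv) : List Γ' :=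
  encNat I.lo ++ (encHi I.hi ++ [Γ'.bit I.loClosed, Γ'.bit I.hiClosed])

def encEndpoint : Endpoint → List Γ'
  | .start => [Γ'.bit true]
  | .finish => [Γ'.bit false]

def encAtom : Atom → List Γ'
  | .interval o₁ e₁ I e₂ o₂ =>
      Γ'.bra :: (encNat o₁ ++ (encEndpoint e₁ ++ (encIntv I ++ (encEndpoint e₂ ++ encNat o₂))))
  | .lePoint o e I n => Γ'.bit true :: (encNat o ++ (encEndpoint e ++ (encIntv I ++ encNat n)))
  | .pointLe n e I o => Γ'.bit false :: (encNat n ++ (encEndpoint e ++ (encIntv I ++ encNat o)))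

/-- A state variable is written as the list, over its values, of the interval and of the list of
the successors. -/
def encStateVar (x : StateVar) : List Γ' :=
  encList (fun r : Intv × List ℕ => encIntv r.1 ++ encList encNat r.2)
    (List.ofFn fun v => (x.dur v, (x.succs v).map Fin.val))

section

variable {m : ℕ} {X : Fin m → StateVar}

def encQuantifier (q : Quantifier X) : List Γ' :=
  encNat q.name ++ (encNat q.sv ++ encNat q.val)

def encExStmt (E : ExStmt X) : List Γ' :=
  encList encQuantifier E.quants ++ encList encAtom E.atoms

def encRule : Rule X → List Γ'
  | .trigger t b => Γ'.bit true :: (encQuantifier t ++ encList encExStmt b)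
  | .triggerless b => Γ'.bit false :: encList encExStmt b

end

def encDomain (P : Domain) : List Γ' :=
  encList encStateVar (List.ofFn P.var) ++ encList encRule P.rules

/-- The code of an object can be recovered from any string that it begins. -/
def SelfDelim {α : Type} (e : α → List Γ') : Prop :=
  ∀ a b s t, e a ++ s = e b ++ t → a = b ∧ s = t

theorem selfDelim_encNat : SelfDelim encNat := by
  have key : ∀ (l l' : List Bool) (s t : List Γ'),
      l.map Γ'.bit ++ (Γ'.comma :: s) = l'.map Γ'.bit ++ (Γ'.comma :: t) → l = l' ∧ s = t := by
    intro l
    induction l with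
    | nil => intro l' s t h; cases l' <;> simp_all
    | cons a l ih =>
      intro l' s t h
      cases l' with
      | nil => simp at h
      | cons b l' =>
        simp only [List.map_cons, List.cons_append, List.cons.injEq, Γ'.bit.injEq] at h
        obtain ⟨h1, h2⟩ := ih l' s t h.2
        exact ⟨by rw [h.1, h1], h2⟩
  intro a b s t h
  simp only [encNat, List.append_assoc, List.singleton_append] at h
  obtain ⟨h1, h2⟩ := key _ _ _ _ h
  exact ⟨encodingNatBool.encode_injective h1, h2⟩

theorem selfDelim_encList {α : Type} {e : α → List Γ'} (he : SelfDelim e) :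
    SelfDelim (encList e) := by
  intro l
  induction l with
  | nil => intro l' s t h; cases l' <;> simp_all [encList]
  | cons a l ih =>
    intro l' s t h
    cases l' with
    | nil => simp [encList] at h
    | cons b l' =>
      simp only [encList, List.cons_append, List.append_assoc, List.cons.injEq, true_and] at h
      obtain ⟨h1, h2⟩ := he _ _ _ _ h
      obtain ⟨h3, h4⟩ := ih _ _ _ h2
      exact ⟨by rw [h1, h3], h4⟩

theorem selfDelim_encHi : SelfDelim encHi := by
  have hne : ∀ (n : ℕ) (s t : List Γ'), encNat n ++ s ≠ Γ'.blank :: t := by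
    intro n s t h
    unfold encNat at h
    cases hn : encodeNat n <;> simp [hn] at h
  intro a b s t h
  cases a with
  | none =>
    cases b with
    | none => simpa [encHi] using h
    | some n => exact absurd h.symm (hne n t s)
  | some n =>
    cases b with
    | none => exact absurd h (hne n s t)
    | some k =>
      obtain ⟨h1, h2⟩ := selfDelim_encNat _ _ _ _ h
      exact ⟨by rw [h1], h2⟩

theorem selfDelim_encIntv : SelfDelim encIntv := by
  rintro ⟨a, b, c, d⟩ ⟨a', b', c', d'⟩ s t h
  simp only [encIntv, List.append_assoc] at h
  obtain ⟨h1, h⟩ := selfDelim_encNat _ _ _ _ h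
  obtain ⟨h2, h⟩ := selfDelim_encHi _ _ _ _ h
  simp at h
  simp [h1, h2, h]

theorem selfDelim_encEndpoint : SelfDelim encEndpoint := by
  intro a b s t h
  cases a <;> cases b <;> simp_all [encEndpoint]

theorem selfDelim_encAtom : SelfDelim encAtom := by
  intro a b s t h
  cases a <;> cases b <;>
    simp only [encAtom, List.cons_append, List.append_assoc, List.cons.injEq, true_and,
      reduceCtorEq, false_and, Γ'.bit.injEq] at h
  · obtain ⟨h1, h⟩ := selfDelim_encNat _ _ _ _ h
    obtain ⟨h2, h⟩ := selfDelim_encEndpoint _ _ _ _ h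
    obtain ⟨h3, h⟩ := selfDelim_encIntv _ _ _ _ h
    obtain ⟨h4, h⟩ := selfDelim_encEndpoint _ _ _ _ h
    obtain ⟨h5, h⟩ := selfDelim_encNat _ _ _ _ h
    simp [h1, h2, h3, h4, h5, h]
  all_goals
    obtain ⟨h1, h⟩ := selfDelim_encNat _ _ _ _ h
    obtain ⟨h2, h⟩ := selfDelim_encEndpoint _ _ _ _ h
    obtain ⟨h3, h⟩ := selfDelim_encIntv _ _ _ _ h
    obtain ⟨h4, h⟩ := selfDelim_encNat _ _ _ _ h
    simp [h1, h2, h3, h4, h]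

theorem selfDelim_encStateVar : SelfDelim encStateVar := by
  have hpair : SelfDelim (fun r : Intv × List ℕ => encIntv r.1 ++ encList encNat r.2) := by
    rintro ⟨a, b⟩ ⟨a', b'⟩ s t h
    simp only [List.append_assoc] at h
    obtain ⟨h1, h⟩ := selfDelim_encIntv _ _ _ _ h
    obtain ⟨h2, h⟩ := selfDelim_encList selfDelim_encNat _ _ _ _ h
    exact ⟨by rw [h1, h2], h⟩
  rintro ⟨n, f, g⟩ ⟨n', f', g'⟩ s t h
  obtain ⟨h1, h⟩ := selfDelim_encList hpair _ _ _ _ h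
  refine ⟨?_, h⟩
  have hn : n = n' := by simpa using congrArg List.length h1
  subst hn
  have h2 := List.ofFn_injective h1
  have hg : g = g' := funext fun v => congrArg Prod.fst (congrFun h2 v)
  have hf : f = f' := funext fun v =>
    List.map_injective_iff.2 Fin.val_injective (congrArg Prod.snd (congrFun h2 v))
  rw [hf, hg]

section

variable {m : ℕ} {X : Fin m → StateVar}

theorem selfDelim_encQuantifier : SelfDelim (encQuantifier (X := X)) := by
  rintro ⟨a, x, v⟩ ⟨a', x', v'⟩ s t h
  simp only [encQuantifier, List.append_assoc] at h
  obtain ⟨h1, k1⟩ := selfDelim_encNat _ _ _ _ h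
  obtain ⟨h2, k2⟩ := selfDelim_encNat _ _ _ _ k1
  obtain ⟨h3, k3⟩ := selfDelim_encNat _ _ _ _ k2
  have h2' := Fin.val_injective h2
  subst h2'
  have h3' := Fin.val_injective h3
  subst h3'
  subst h1
  exact ⟨rfl, k3⟩

theorem selfDelim_encExStmt : SelfDelim (encExStmt (X := X)) := by
  rintro ⟨a, b⟩ ⟨a', b'⟩ s t h
  simp only [encExStmt, List.append_assoc] at h
  obtain ⟨h1, h⟩ := selfDelim_encList selfDelim_encQuantifier _ _ _ _ h
  obtain ⟨h2, h⟩ := selfDelim_encList selfDelim_encAtom _ _ _ _ h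
  exact ⟨by rw [h1, h2], h⟩

theorem selfDelim_encRule : SelfDelim (encRule (X := X)) := by
  intro a b s t h
  cases a <;> cases b <;>
    simp only [encRule, List.cons_append, List.append_assoc, List.cons.injEq, true_and,
      reduceCtorEq, false_and, Γ'.bit.injEq] at h
  · obtain ⟨h1, h⟩ := selfDelim_encQuantifier _ _ _ _ h
    obtain ⟨h2, h⟩ := selfDelim_encList selfDelim_encExStmt _ _ _ _ h
    exact ⟨by rw [h1, h2], h⟩
  · obtain ⟨h2, h⟩ := selfDelim_encList selfDelim_encExStmt _ _ _ _ h
    exact ⟨by rw [h2], h⟩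

end

theorem encDomain_injective : Function.Injective encDomain := by
  rintro ⟨n, X, R⟩ ⟨n', X', R'⟩ h
  obtain ⟨h1, h⟩ := selfDelim_encList selfDelim_encStateVar _ _ _ _ h
  have hn : n = n' := by simpa using congrArg List.length h1
  subst hn
  have hX : X = X' := List.ofFn_injective h1
  subst hX
  have h2 := selfDelim_encList (selfDelim_encRule (X := X)) R R' [] [] (by simpa using h)
  rw [h2.1]

/-- The encoding of TP domains by strings over a finite alphabet. -/
noncomputable def domainEncoding : Encoding Domain Γ' where
  encode := encDomain
  decode := Function.partialInv encDomain
  decode_encode := Function.partialInv_left encDomain_injective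

end Encoding

end TP

/-! A language in PSPACE is decided by a run whose configurations have polynomially bounded height.
Each configuration is written as a row of N = M + 1 cells and the rows are concatenated, so that a
run becomes a finite sequence of tiles. A tile carries a cell, its two neighbours and the first cell
of its row (state and stack tops); hence the cell found N places later is a function of the tile
alone. Tiles of accepting configurations need no successor. A finite tile sequence therefore exists
exactly when the machine accepts (`exists_accepting_of_relSolvable`, `relSolvable_of_accepting`).

The difficulty is to say "exactly N places later" with intervals `[0, a]` only. The values of the
single state variable are tiles tagged with a position modulo N, and tokens last at least 1. A
trigger rule asks for an allowed tile at the same position that starts within `[0, M + 2]` after the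
end of the trigger. At most M + 2 tokens fit in between, and equality of positions modulo N then
leaves only the distance N, provided that M ≥ 2. Each such rule has one quantified name in one atom,
so it is simple. The first row is forced by time-point atoms (`hasFuturePlan_domain_iff`).

The initial rules are printed bit by bit, so an initial tile cannot know its neighbours or the first
cell. For this reason the machine idles in its first step, and the compatibility of tiles is relaxed
in the start state (`Agree`).

Polynomial-time computability needs an actual machine. The programs `Cmd` compile to `FinTM2` with a
step bound (`Run.within`); a generator prints templates whose holes are filled with a binary counter
(`Gen.computable`), and its output is the code of the domain (`encDomain_eq`). On the source side,
`InPSPACE.exists_stackMachine` splits a `TM2` program into single instructions. -/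

namespace TP

/-! ## Structured programs over stacks, and their compilation to `FinTM2` -/

/-- Programs over a family of stacks. `pop k f` pops stack `k` and branches on the result;
`loop k f` pops stack `k` until it is empty, executing `f a` for each symbol `a` found. -/
inductive Cmd {K : Type} (Γ : K → Type) : Type where
  | skip : Cmd Γ
  | push (k : K) (a : Γ k) : Cmd Γ
  | seq (c₁ c₂ : Cmd Γ) : Cmd Γ
  | pop (k : K) (f : Option (Γ k) → Cmd Γ) : Cmd Γ
  | loop (k : K) (f : Γ k → Cmd Γ) : Cmd Γ

namespace Cmd

variable {K : Type} {Γ : K → Type}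

/-- Program points. -/
def Lab : Cmd Γ → Type
  | skip => Unit
  | push _ _ => Unit
  | seq c₁ c₂ => Lab c₁ ⊕ Lab c₂
  | pop k f => Option (Σ o : Option (Γ k), Lab (f o))
  | loop k f => Option (Σ a : Γ k, Lab (f a))

/-- There are finitely many program points. -/
@[reducible]
noncomputable def labFintype [∀ k, Fintype (Γ k)] : (c : Cmd Γ) → Fintype (Lab c)
  | skip => inferInstanceAs (Fintype Unit)
  | push _ _ => inferInstanceAs (Fintype Unit)
  | seq c₁ c₂ =>
      letI := labFintype c₁
      letI := labFintype c₂
      inferInstanceAs (Fintype (Lab c₁ ⊕ Lab c₂))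
  | pop k f =>
      letI := fun o => labFintype (f o)
      inferInstanceAs (Fintype (Option (Σ o : Option (Γ k), Lab (f o))))
  | loop k f =>
      letI := fun o => labFintype (f o)
      inferInstanceAs (Fintype (Option (Σ a : Γ k, Lab (f a))))

/-- The point where the execution of a program begins. -/
def entry : (c : Cmd Γ) → Lab c
  | skip => ()
  | push _ _ => ()
  | seq c₁ _ => Sum.inl (entry c₁)
  | pop _ _ => (none : Option _)
  | loop _ _ => (none : Option _)

variable [DecidableEq K]

/-- The internal state of the compiled machine: the last popped symbol. -/
abbrev Reg (Γ : K → Type) : Type := Option (Σ k, Γ k)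

/-- The last popped symbol, if it comes from stack `k`. -/
def Reg.get (v : Reg Γ) (k : K) : Option (Γ k) :=
  v.bind fun p => if h : p.1 = k then some (h ▸ p.2) else none

@[simp]
theorem Reg.get_map (k : K) (o : Option (Γ k)) :
    Reg.get (o.map (Sigma.mk k) : Reg Γ) k = o := by
  cases o <;> simp [Reg.get]

/-- The machine code of a program, placed by `emb` in a larger code, and continuing at `exit`. -/
def code {Λ : Type} : (c : Cmd Γ) → (Lab c → Λ) → Λ → Lab c → Turing.TM2.Stmt Γ Λ (Reg Γ)
  | skip, _, exit => fun _ => .goto fun _ => exit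
  | push k a, _, exit => fun _ => .push k (fun _ => a) (.goto fun _ => exit)
  | seq c₁ c₂, emb, exit =>
      Sum.elim (code c₁ (fun l => emb (Sum.inl l)) (emb (Sum.inr (entry c₂))))
        (code c₂ (fun l => emb (Sum.inr l)) exit)
  | pop k f, emb, exit => fun l => Option.elim (α := Σ o, Lab (f o)) l
      (.pop k (fun _ o => o.map (Sigma.mk k)) (.goto fun v => emb (some ⟨v.get k, entry (f (v.get k))⟩)))
      fun p => code (f p.1) (fun l => emb (some ⟨p.1, l⟩)) exit p.2
  | loop k f, emb, exit => fun l => Option.elim (α := Σ a, Lab (f a)) l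
      (.pop k (fun _ o => o.map (Sigma.mk k))
        (.goto fun v => (v.get k).elim exit fun a => emb (some ⟨a, entry (f a)⟩)))
      fun p => code (f p.1) (fun l => emb (some ⟨p.1, l⟩)) (emb (none : Option _)) p.2

/-- `Run c S t S'`: from the stacks `S` the program `c` terminates with the stacks `S'` within `t`
steps. -/
inductive Run : Cmd Γ → (∀ k, List (Γ k)) → ℕ → (∀ k, List (Γ k)) → Prop where
  | skip (S) : Run skip S 1 S
  | push (k a S) : Run (push k a) S 1 (Function.update S k (a :: S k))
  | seq {c₁ c₂ S₁ S₂ S₃ t₁ t₂} : Run c₁ S₁ t₁ S₂ → Run c₂ S₂ t₂ S₃ →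
      Run (seq c₁ c₂) S₁ (t₁ + t₂) S₃
  | pop {k f S S' t} : Run (f (S k).head?) (Function.update S k (S k).tail) t S' →
      Run (pop k f) S (t + 1) S'
  | loop_nil {k f S} : S k = [] → Run (loop k f) S 1 S
  | loop_cons {k f S S' S'' t₁ t₂ a l} : S k = a :: l →
      Run (f a) (Function.update S k l) t₁ S' → Run (loop k f) S' t₂ S'' →
      Run (loop k f) S (t₁ + t₂ + 1) S''
  | weaken {c S S' t t'} : Run c S t S' → t ≤ t' → Run c S t' S'

/-- Reachability within a number of steps. -/
def Within {Λ : Type} (m : Λ → Turing.TM2.Stmt Γ Λ (Reg Γ)) (t : ℕ)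
    (a b : Turing.TM2.Cfg Γ Λ (Reg Γ)) : Prop :=
  ∃ n ≤ t, (flip bind (Turing.TM2.step m))^[n] (some a) = some b

theorem Within.trans {Λ : Type} {m : Λ → Turing.TM2.Stmt Γ Λ (Reg Γ)} {t₁ t₂ : ℕ}
    {a b c : Turing.TM2.Cfg Γ Λ (Reg Γ)} (h₁ : Within m t₁ a b) (h₂ : Within m t₂ b c) :
    Within m (t₁ + t₂) a c := by
  obtain ⟨n₁, l₁, e₁⟩ := h₁
  obtain ⟨n₂, l₂, e₂⟩ := h₂
  refine ⟨n₂ + n₁, by omega, ?_⟩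
  rw [Function.iterate_add_apply, e₁, e₂]

theorem Within.mono {Λ : Type} {m : Λ → Turing.TM2.Stmt Γ Λ (Reg Γ)} {t₁ t₂ : ℕ}
    {a b : Turing.TM2.Cfg Γ Λ (Reg Γ)} (h₁ : Within m t₁ a b) (h : t₁ ≤ t₂) :
    Within m t₂ a b := by
  obtain ⟨n₁, l₁, e₁⟩ := h₁
  exact ⟨n₁, l₁.trans h, e₁⟩

theorem Within.single {Λ : Type} {m : Λ → Turing.TM2.Stmt Γ Λ (Reg Γ)}
    {l : Λ} {v : Reg Γ} {S : ∀ k, List (Γ k)} {b : Turing.TM2.Cfg Γ Λ (Reg Γ)}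
    (h : Turing.TM2.stepAux (m l) v S = b) : Within m 1 ⟨some l, v, S⟩ b :=
  ⟨1, le_rfl, by simp [flip, h]⟩

/-- Induction on the run. The register at the exit is existentially quantified because it is a
leftover of the last pop; this is harmless, since compiled code reads the register only in the step
that has just written it. -/
theorem Run.within {c : Cmd Γ} {S S' : ∀ k, List (Γ k)} {t : ℕ} (h : Run c S t S') :
    ∀ {Λ : Type} (m : Λ → Turing.TM2.Stmt Γ Λ (Reg Γ)) (emb : Lab c → Λ) (exit : Λ),
      (∀ l, m (emb l) = code c emb exit l) → ∀ v, ∃ v',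
      Within m t ⟨some (emb (entry c)), v, S⟩ ⟨some exit, v', S'⟩ := by
  induction h with
  | skip S =>
    intro Λ m emb exit hm v
    exact ⟨v, Within.single (congrArg (Turing.TM2.stepAux · _ _) (hm _))⟩
  | push k a S =>
    intro Λ m emb exit hm v
    exact ⟨v, Within.single (congrArg (Turing.TM2.stepAux · _ _) (hm _))⟩
  | seq _ _ ih₁ ih₂ =>
    intro Λ m emb exit hm v
    obtain ⟨v₁, h₁⟩ := ih₁ m (fun l => emb (Sum.inl l)) (emb (Sum.inr (entry _)))
      (fun l => hm (Sum.inl l)) v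
    obtain ⟨v₂, h₂⟩ := ih₂ m (fun l => emb (Sum.inr l)) exit (fun l => hm (Sum.inr l)) v₁
    exact ⟨v₂, h₁.trans h₂⟩
  | @pop k f S S' t _ ih =>
    intro Λ m emb exit hm v
    obtain ⟨v₁, h₁⟩ := ih m (fun l => emb (some ⟨_, l⟩)) exit
      (fun l => hm (some ⟨_, l⟩)) ((S k).head?.map (Sigma.mk k))
    refine ⟨v₁, ?_⟩
    rw [add_comm]
    refine Within.trans (Within.single ?_) h₁
    exact (congrArg (Turing.TM2.stepAux · _ _) (hm (none : Option _))).trans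
      (congrArg (fun o => (⟨some (emb (some ⟨o, entry (f o)⟩)), _, _⟩ : Turing.TM2.Cfg Γ Λ _))
        (Reg.get_map _ _))
  | @loop_nil k f S hS =>
    intro Λ m emb exit hm v
    refine ⟨none, Within.single ?_⟩
    refine (congrArg (Turing.TM2.stepAux · _ _) (hm (none : Option _))).trans ?_
    simp [code, Turing.TM2.stepAux, hS, Reg.get]
  | @loop_cons k f S S' S'' t₁ t₂ a l hS _ _ ih₁ ih₂ =>
    intro Λ m emb exit hm v
    obtain ⟨v₁, h₁⟩ := ih₁ m (fun l => emb (some ⟨a, l⟩)) (emb (none : Option _))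
      (fun l => hm (some ⟨a, l⟩)) (some ⟨k, a⟩)
    obtain ⟨v₂, h₂⟩ := ih₂ m emb exit hm v₁
    refine ⟨v₂, ?_⟩
    have h₃ : Within m 1 ⟨some (emb (entry (loop k f))), v, S⟩
        ⟨some (emb (some ⟨a, entry (f a)⟩)), some ⟨k, a⟩, Function.update S k l⟩ := by
      refine Within.single ?_
      refine (congrArg (Turing.TM2.stepAux · _ _) (hm (none : Option _))).trans ?_
      simp [code, Turing.TM2.stepAux, hS, Reg.get]
    exact ((h₃.trans h₁).trans h₂).mono (by omega)
  | weaken _ hle ih =>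
    intro Λ m emb exit hm v
    obtain ⟨v₁, h₁⟩ := ih m emb exit hm v
    exact ⟨v₁, h₁.mono hle⟩

/-- The machine that executes a program and then halts with a clean internal state. -/
noncomputable def machine [Fintype K] [∀ k, Fintype (Γ k)] (c : Cmd Γ) (k₀ k₁ : K) :
    Turing.FinTM2 :=
  letI := labFintype c
  { K := K
    k₀ := k₀
    k₁ := k₁
    Γ := Γ
    Λ := Option (Lab c)
    main := some (entry c)
    σ := Reg Γ
    initialState := none
    m := fun l => match l with
      | none => .load (fun _ => none) .halt
      | some l => code c some none l }

theorem dite_eq_update (k₀ : K) (l : List (Γ k₀)) :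
    (fun k => dite (k = k₀) (fun h => by rw [h]; exact l) fun _ => []) =
      Function.update (fun k => ([] : List (Γ k))) k₀ l := by
  funext k
  by_cases hk : k = k₀
  · subst hk; simp
  · simp [hk]

theorem outputsInTime_machine [Fintype K] [∀ k, Fintype (Γ k)] (c : Cmd Γ) (k₀ k₁ : K)
    {l : List (Γ k₀)} {l' : List (Γ k₁)} {t : ℕ}
    (h : Run c (Function.update (fun _ => []) k₀ l) t (Function.update (fun _ => []) k₁ l')) :
    Nonempty (Turing.TM2OutputsInTime (machine c k₀ k₁) l (some l') (t + 1)) := by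
  obtain ⟨v, h₁⟩ := h.within (machine c k₀ k₁).m some none (fun _ => rfl) none
  -- The additional step resets the register, because a halting configuration must have the initial
  -- internal state.
  have h₂ : Within (machine c k₀ k₁).m 1 ⟨some none, v, Function.update (fun _ => []) k₁ l'⟩
      ⟨none, none, Function.update (fun _ => []) k₁ l'⟩ := Within.single rfl
  obtain ⟨n, hn, e⟩ := h₁.trans h₂
  refine ⟨⟨⟨n, ?_⟩, hn⟩⟩
  refine Eq.trans ?_ (e.trans ?_)
  · refine congrArg (fun S => (flip bind (Turing.TM2.step (machine c k₀ k₁).m))^[n]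
      (some ⟨some (some (entry c)), none, S⟩)) ?_
    exact dite_eq_update k₀ l
  · refine congrArg (fun S => some (⟨none, none, S⟩ : (machine c k₀ k₁).Cfg)) ?_
    exact (dite_eq_update k₁ l').symm

end Cmd

end TP

namespace TP

open Computability

/-! ## Binary counters -/

/-- Increment of a binary number, least significant bit first. -/
def binSucc : List Bool → List Bool
  | [] => [true]
  | true :: l => false :: binSucc l
  | false :: l => true :: l

theorem encodePosNum_succ (p : PosNum) : encodePosNum p.succ = binSucc (encodePosNum p) := by
  induction p with
  | one => rfl
  | bit1 p ih => simp [PosNum.succ, encodePosNum, binSucc, ih]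
  | bit0 p => rfl

theorem encodeNat_succ (n : ℕ) : encodeNat (n + 1) = binSucc (encodeNat n) := by
  have h : ((n + 1 : ℕ) : Num) = Num.succ (n : Num) := by
    rw [Nat.cast_succ, Num.add_one]
  unfold encodeNat
  rw [h]
  cases (n : Num) with
  | zero => rfl
  | pos p => exact encodePosNum_succ p

theorem encodeNat_zero : encodeNat 0 = [] := rfl

theorem encodeNat_one : encodeNat 1 = [true] := by
  rw [encodeNat_succ, encodeNat_zero]; rfl

theorem length_binSucc_le (l : List Bool) : (binSucc l).length ≤ l.length + 1 := by
  induction l with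
  | nil => simp [binSucc]
  | cons b l ih => cases b <;> simp [binSucc, ih]

theorem length_encodeNat_le (n : ℕ) : (encodeNat n).length ≤ n := by
  induction n with
  | zero => simp [encodeNat_zero]
  | succ n ih => rw [encodeNat_succ]; exact (length_binSucc_le _).trans (by omega)

/-! ## The memory of the reduction -/

/-- The stacks used by the reduction. -/
inductive Stk where
  | inp | out | u | u' | x | y | j | t | a | cy | o
  deriving DecidableEq

instance : Fintype Stk where
  elems := {.inp, .out, .u, .u', .x, .y, .j, .t, .a, .cy, .o}
  complete k := by cases k <;> simp

/-- The stack alphabets. -/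
abbrev Stk.Sym : Stk → Type
  | .inp | .j | .t | .a => Bool
  | .u | .u' | .x | .y | .cy => Unit
  | .out | .o => Γ'

instance Stk.fintypeSym : ∀ k, Fintype (Stk.Sym k)
  | .inp | .j | .t | .a => inferInstanceAs (Fintype Bool)
  | .u | .u' | .x | .y | .cy => inferInstanceAs (Fintype Unit)
  | .out | .o => inferInstanceAs (Fintype Γ')

/-- The contents of the stacks. -/
structure Mem where
  inp : List Bool := []
  out : List Γ' := []
  u : List Unit := []
  u' : List Unit := []
  x : List Unit := []
  y : List Unit := []
  j : List Bool := []
  t : List Bool := []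
  a : List Bool := []
  cy : List Unit := []
  o : List Γ' := []

/-- The contents of the stacks, as a function. -/
def Mem.get (s : Mem) : ∀ k, List (Stk.Sym k)
  | .inp => s.inp
  | .out => s.out
  | .u => s.u
  | .u' => s.u'
  | .x => s.x
  | .y => s.y
  | .j => s.j
  | .t => s.t
  | .a => s.a
  | .cy => s.cy
  | .o => s.o

/-- Programs over the memory. -/
abbrev Prog : Type := Cmd Stk.Sym

/-- From `s` the program `c` terminates in `s'` within `t` steps. -/
def Exec (c : Prog) (s : Mem) (t : ℕ) (s' : Mem) : Prop := Cmd.Run c s.get t s'.get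

namespace Exec

open Cmd

theorem skip (s : Mem) : Exec .skip s 1 s := Run.skip _

theorem seq {c₁ c₂ : Prog} {s₁ s₂ s₃ : Mem} {t₁ t₂ : ℕ} (h₁ : Exec c₁ s₁ t₁ s₂)
    (h₂ : Exec c₂ s₂ t₂ s₃) : Exec (.seq c₁ c₂) s₁ (t₁ + t₂) s₃ := Run.seq h₁ h₂

theorem weaken {c : Prog} {s s' : Mem} {t t' : ℕ} (h : Exec c s t s') (ht : t ≤ t') :
    Exec c s t' s' := Run.weaken h ht

theorem push {k : Stk} {a : Stk.Sym k} {s s' : Mem}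
    (h : s'.get = Function.update s.get k (a :: s.get k) := by
      funext k; cases k <;> simp [Mem.get, List.replicate_succ]) : Exec (.push k a) s 1 s' := by
  unfold Exec; rw [h]; exact Run.push _ _ _

theorem pop {k : Stk} {f : Option (Stk.Sym k) → Prog} {s s₁ s' : Mem} {t : ℕ}
    (o : Option (Stk.Sym k)) (h : Exec (f o) s₁ t s')
    (ho : (s.get k).head? = o := by simp [Mem.get])
    (hs : s₁.get = Function.update s.get k (s.get k).tail := by
      funext k; cases k <;> simp [Mem.get]) :
    Exec (.pop k f) s (t + 1) s' := by
  subst ho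
  unfold Exec at h; rw [hs] at h
  exact Run.pop h

theorem loop_nil {k : Stk} {f : Stk.Sym k → Prog} {s : Mem}
    (h : s.get k = [] := by simp [Mem.get]) : Exec (.loop k f) s 1 s := Run.loop_nil h

theorem loop_cons {k : Stk} {f : Stk.Sym k → Prog} {s s₁ s₂ s₃ : Mem} {t₁ t₂ : ℕ}
    (a : Stk.Sym k) (l : List (Stk.Sym k))
    (h₁ : Exec (f a) s₁ t₁ s₂) (h₂ : Exec (.loop k f) s₂ t₂ s₃)
    (h : s.get k = a :: l := by simp [Mem.get, List.replicate_succ])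
    (hs : s₁.get = Function.update s.get k l := by
      funext k; cases k <;> simp [Mem.get, List.replicate_succ]) :
    Exec (.loop k f) s (t₁ + t₂ + 1) s₃ := by
  unfold Exec at h₁; rw [hs] at h₁
  exact Run.loop_cons h h₁ h₂

theorem of {c : Prog} {s s' s'' : Mem} {t t' : ℕ} (h : Exec c s t s') (ht : t ≤ t')
    (hs : s' = s'') : Exec c s t' s'' := hs ▸ h.weaken ht

end Exec

/-! ## Templates -/

/-- A string with holes: `inr false` stands for the counter, `inr true` for the window. -/
abbrev Template : Type := List (Γ' ⊕ Bool)

/-- Fill the holes of a template. -/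
def Template.fill (j a : List Bool) (m : Template) : List Γ' :=
  m.flatMap (Sum.elim (fun g => [g]) fun b => (if b then a else j).map Γ'.bit)

/-- Output the counter. -/
def emitJ : Prog :=
  .seq (.loop .j fun b => .seq (.push .t b) (.push .o (Γ'.bit b))) (.loop .t fun b => .push .j b)

/-- Output the window. -/
def emitA : Prog :=
  .seq (.loop .a fun b => .seq (.push .t b) (.push .o (Γ'.bit b))) (.loop .t fun b => .push .a b)

/-- Output a filled template. -/
def emit (m : Template) : Prog :=
  m.foldr (fun i c => .seq (i.elim (fun g => .push .o g) fun b => if b then emitA else emitJ) c)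
    .skip

/-- Increment the counter. -/
def incr : Prog :=
  .seq (.push .cy ()) <| .seq
    (.loop .j fun b => .pop .cy fun o =>
      match o, b with
      | none, b => .push .t b
      | some _, true => .seq (.push .t false) (.push .cy ())
      | some _, false => .push .t true) <| .seq
    (.pop .cy fun o =>
      match o with
      | none => .skip
      | some _ => .push .t true)
    (.loop .t fun b => .push .j b)

open Exec

variable {inp : List Bool} {out : List Γ'} {u u' x y : List Unit} {j t a : List Bool}
  {cy : List Unit} {o : List Γ'}

theorem exec_unload_j (l : List Bool) :
    Exec (.loop .t fun b => .push .j b) ⟨inp, out, u, u', x, y, j, l, a, cy, o⟩ (2 * l.length + 1)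
      ⟨inp, out, u, u', x, y, l.reverse ++ j, [], a, cy, o⟩ := by
  induction l generalizing j with
  | nil => exact loop_nil
  | cons b l ih =>
    exact Exec.of (loop_cons (s₁ := ⟨inp, out, u, u', x, y, j, l, a, cy, o⟩) b l push
      (ih (j := b :: j))) (by simp; omega) (by simp)

theorem exec_unload_a (l : List Bool) :
    Exec (.loop .t fun b => .push .a b) ⟨inp, out, u, u', x, y, j, l, a, cy, o⟩ (2 * l.length + 1)
      ⟨inp, out, u, u', x, y, j, [], l.reverse ++ a, cy, o⟩ := by
  induction l generalizing a with
  | nil => exact loop_nil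
  | cons b l ih =>
    exact Exec.of (loop_cons (s₁ := ⟨inp, out, u, u', x, y, j, l, a, cy, o⟩) b l push
      (ih (a := b :: a))) (by simp; omega) (by simp)

theorem exec_emitJ :
    Exec emitJ ⟨inp, out, u, u', x, y, j, [], a, cy, o⟩ (5 * j.length + 2)
      ⟨inp, out, u, u', x, y, j, [], a, cy, (j.map Γ'.bit).reverse ++ o⟩ := by
  have key : ∀ (l t : List Bool) (o : List Γ'),
      Exec (.loop .j fun b => .seq (.push .t b) (.push .o (Γ'.bit b)))
        ⟨inp, out, u, u', x, y, l, t, a, cy, o⟩ (3 * l.length + 1)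
        ⟨inp, out, u, u', x, y, [], l.reverse ++ t, a, cy, (l.map Γ'.bit).reverse ++ o⟩ := by
    intro l
    induction l with
    | nil => intro t o; exact loop_nil
    | cons b l ih =>
      intro t o
      exact Exec.of (loop_cons (s₁ := ⟨inp, out, u, u', x, y, l, t, a, cy, o⟩) b l
        (seq (s₂ := ⟨inp, out, u, u', x, y, l, b :: t, a, cy, o⟩) push push)
        (ih (b :: t) (Γ'.bit b :: o))) (by simp; omega) (by simp)
  exact Exec.of ((key j [] o).seq (exec_unload_j _)) (by simp; omega) (by simp)

theorem exec_emitA :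
    Exec emitA ⟨inp, out, u, u', x, y, j, [], a, cy, o⟩ (5 * a.length + 2)
      ⟨inp, out, u, u', x, y, j, [], a, cy, (a.map Γ'.bit).reverse ++ o⟩ := by
  have key : ∀ (l t : List Bool) (o : List Γ'),
      Exec (.loop .a fun b => .seq (.push .t b) (.push .o (Γ'.bit b)))
        ⟨inp, out, u, u', x, y, j, t, l, cy, o⟩ (3 * l.length + 1)
        ⟨inp, out, u, u', x, y, j, l.reverse ++ t, [], cy, (l.map Γ'.bit).reverse ++ o⟩ := by
    intro l
    induction l with
    | nil => intro t o; exact loop_nil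
    | cons b l ih =>
      intro t o
      exact Exec.of (loop_cons (s₁ := ⟨inp, out, u, u', x, y, j, t, l, cy, o⟩) b l
        (seq (s₂ := ⟨inp, out, u, u', x, y, j, b :: t, l, cy, o⟩) push push)
        (ih (b :: t) (Γ'.bit b :: o))) (by simp; omega) (by simp)
  exact Exec.of ((key a [] o).seq (exec_unload_a _)) (by simp; omega) (by simp)

/-- The text is pushed on `o`, hence appears reversed there; `exec_flush` turns it round at the end.
Printing a hole costs five steps per bit, since the bits are moved to `t` and back. -/
theorem exec_emit (m : Template) :
    Exec (emit m) ⟨inp, out, u, u', x, y, j, [], a, cy, o⟩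
      (m.length * (5 * (j.length + a.length) + 2) + 1)
      ⟨inp, out, u, u', x, y, j, [], a, cy, (m.fill j a).reverse ++ o⟩ := by
  induction m generalizing o with
  | nil => exact Exec.of (skip _) (by simp) (by simp [Template.fill])
  | cons i m ih =>
    rcases i with g | _ | _
    · exact Exec.of (seq push (ih (o := g :: o))) (by simp; ring_nf; omega)
        (by simp [Template.fill])
    · exact Exec.of (seq exec_emitJ ih) (by simp; ring_nf; omega) (by simp [Template.fill])
    · exact Exec.of (seq exec_emitA ih) (by simp; ring_nf; omega) (by simp [Template.fill])

/-- The stack `cy` holds the carry, as one unit or nothing: each digit of `j` consumes it and may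
recreate it. The digits pass through `t` and are thus reversed twice; a carry that survives becomes
the new leading digit. -/
theorem exec_incr :
    Exec incr ⟨inp, out, u, u', x, y, j, [], a, [], o⟩ (6 * j.length + 9)
      ⟨inp, out, u, u', x, y, binSucc j, [], a, [], o⟩ := by
  have key : ∀ (l t : List Bool) (c : Bool), ∃ (l' : List Bool) (c' : Bool),
      Exec (.loop .j fun b => .pop .cy fun o =>
          match o, b with
          | none, b => .push .t b
          | some _, true => .seq (.push .t false) (.push .cy ())
          | some _, false => .push .t true)
        ⟨inp, out, u, u', x, y, l, t, a, if c then [()] else [], o⟩ (4 * l.length + 1)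
        ⟨inp, out, u, u', x, y, [], l' ++ t, a, if c' then [()] else [], o⟩ ∧
      (if c' then true :: l' else l').reverse = if c then binSucc l else l := by
    intro l
    induction l with
    | nil =>
      intro t c
      exact ⟨[], c, Exec.of loop_nil (by simp) (by simp), by cases c <;> simp [binSucc]⟩
    | cons b l ih =>
      intro t c
      cases c with
      | false =>
        obtain ⟨l', c', h, e⟩ := ih (b :: t) false
        refine ⟨l' ++ [b], c', Exec.of
          (loop_cons (s₁ := ⟨inp, out, u, u', x, y, l, t, a, [], o⟩) b l
            (pop none (s₁ := ⟨inp, out, u, u', x, y, l, t, a, [], o⟩) push) h)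
          (by simp; omega) (by simp), ?_⟩
        cases c' <;> simp_all
      | true =>
        cases b with
        | false =>
          obtain ⟨l', c', h, e⟩ := ih (true :: t) false
          refine ⟨l' ++ [true], c', Exec.of
            (loop_cons (s₁ := ⟨inp, out, u, u', x, y, l, t, a, [()], o⟩) false l
              (pop (some ()) (s₁ := ⟨inp, out, u, u', x, y, l, t, a, [], o⟩) push) h)
            (by simp; omega) (by simp), ?_⟩
          cases c' <;> simp_all [binSucc]
        | true =>
          obtain ⟨l', c', h, e⟩ := ih (false :: t) true
          refine ⟨l' ++ [false], c', Exec.of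
            (loop_cons (s₁ := ⟨inp, out, u, u', x, y, l, t, a, [()], o⟩) true l
              (pop (some ()) (s₁ := ⟨inp, out, u, u', x, y, l, t, a, [], o⟩)
                (seq (s₂ := ⟨inp, out, u, u', x, y, l, false :: t, a, [], o⟩) push push)) h)
            (by simp; omega) (by simp), ?_⟩
          cases c' <;> simp_all [binSucc]
  obtain ⟨l', c', h, e⟩ := key j [] true
  have hl : l'.length ≤ j.length + 1 := by
    have := congrArg List.length e
    have h2 := length_binSucc_le j
    cases c' <;> simp at this <;> omega
  have h0 : Exec (.push .cy ()) ⟨inp, out, u, u', x, y, j, [], a, [], o⟩ 1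
    ⟨inp, out, u, u', x, y, j, [], a, [()], o⟩ := push
  cases c' with
  | false =>
    exact Exec.of (seq h0 (seq h (seq (pop none (s₁ := ⟨inp, out, u, u', x, y, [], l', a, [], o⟩)
      (skip _) (by simp [Mem.get])
      (by funext k; cases k <;> simp [Mem.get])) (exec_unload_j l')))) (by simp; omega)
      (by simpa using e)
  | true =>
    have h1 : Exec (.push .t true) ⟨inp, out, u, u', x, y, [], l', a, [], o⟩ 1
      ⟨inp, out, u, u', x, y, [], true :: l', a, [], o⟩ := push
    exact Exec.of (seq h0 (seq h (seq (pop (some ()) h1 (by simp [Mem.get])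
      (by funext k; cases k <;> simp [Mem.get])) (exec_unload_j (true :: l'))))) (by simp; omega)
      (by simpa using e)

end TP

namespace TP

open Computability Exec

variable {inp : List Bool} {out : List Γ'} {u u' x y : List Unit} {j t a : List Bool}
  {cy : List Unit} {o : List Γ'}

/-! ## Unary arithmetic -/

/-- Put `n + 1` on stack `x`, where `n` is the length of the input. -/
def loadX : Prog :=
  .seq (.loop .inp fun b => .seq (.push .t b) (.push .x ())) <| .seq
    (.loop .t fun b => .push .inp b) (.push .x ())

/-- Multiply `u` by `x`. -/
def mulX : Prog :=
  .seq (.loop .u fun _ => .seq (.loop .x fun _ => .seq (.push .y ()) (.push .u' ()))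
    (.loop .y fun _ => .push .x ())) (.loop .u' fun _ => .push .u ())

/-- Multiply `u` by the `k`-th power of `x`. -/
def powX : ℕ → Prog
  | 0 => .skip
  | k + 1 => .seq (powX k) mulX

/-- Add `c` to `u`. -/
def addU : ℕ → Prog
  | 0 => .skip
  | c + 1 => .seq (addU c) (.push .u ())

/-- The number `n` in unary. -/
abbrev un (n : ℕ) : List Unit := List.replicate n ()

theorem exec_loadX :
    Exec loadX ⟨inp, out, u, u', [], y, j, [], a, cy, o⟩ (5 * inp.length + 3)
      ⟨inp, out, u, u', un (inp.length + 1), y, j, [], a, cy, o⟩ := by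
  have h₁ : ∀ (l t : List Bool) (n : ℕ),
      Exec (.loop .inp fun b => .seq (.push .t b) (.push .x ()))
        ⟨l, out, u, u', un n, y, j, t, a, cy, o⟩ (3 * l.length + 1)
        ⟨[], out, u, u', un (n + l.length), y, j, l.reverse ++ t, a, cy, o⟩ := by
    intro l
    induction l with
    | nil => intro t n; exact loop_nil
    | cons b l ih =>
      intro t n
      exact Exec.of (loop_cons (s₁ := ⟨l, out, u, u', un n, y, j, t, a, cy, o⟩) b l
        (seq (s₂ := ⟨l, out, u, u', un n, y, j, b :: t, a, cy, o⟩) push push)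
        (ih (b :: t) (n + 1))) (by simp; omega) (by simp; omega)
  have h₂ : ∀ (l i : List Bool) (x : List Unit),
      Exec (.loop .t fun b => .push .inp b)
        ⟨i, out, u, u', x, y, j, l, a, cy, o⟩ (2 * l.length + 1)
        ⟨l.reverse ++ i, out, u, u', x, y, j, [], a, cy, o⟩ := by
    intro l
    induction l with
    | nil => intro i x; exact loop_nil
    | cons b l ih =>
      intro i x
      exact Exec.of (loop_cons (s₁ := ⟨i, out, u, u', x, y, j, l, a, cy, o⟩) b l push
        (ih (b :: i) x)) (by simp; omega) (by simp)
  have h₃ : Exec (.push .x ())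
      ⟨inp.reverse.reverse ++ [], out, u, u', un inp.length, y, j, [], a, cy, o⟩ 1
      ⟨inp.reverse.reverse ++ [], out, u, u', un (inp.length + 1), y, j, [], a, cy, o⟩ := push
  exact Exec.of (seq ((h₁ inp [] 0).of le_rfl (by simp))
    (seq (h₂ inp.reverse [] (un inp.length)) h₃)) (by simp; omega) (by simp)

/-- Every unit of `u` copies `x` into `u'`, with `y` used to restore `x`, for at most 5q + 3 steps
per round; the final move of the product costs the remaining 2mq. -/
theorem exec_mulX (m q : ℕ) :
    Exec mulX ⟨inp, out, un m, [], un q, [], j, t, a, cy, o⟩ (m * (7 * q + 3) + 2)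
      ⟨inp, out, un (m * q), [], un q, [], j, t, a, cy, o⟩ := by
  have h₁ : ∀ (q r s : ℕ) (u : List Unit),
      Exec (.loop .x fun _ => .seq (.push .y ()) (.push .u' ()))
        ⟨inp, out, u, un s, un q, un r, j, t, a, cy, o⟩ (3 * q + 1)
        ⟨inp, out, u, un (s + q), [], un (r + q), j, t, a, cy, o⟩ := by
    intro q
    induction q with
    | zero => intro r s u; exact loop_nil
    | succ q ih =>
      intro r s u
      exact Exec.of (loop_cons (s₁ := ⟨inp, out, u, un s, un q, un r, j, t, a, cy, o⟩) () (un q)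
        (seq (s₂ := ⟨inp, out, u, un s, un q, un (r + 1), j, t, a, cy, o⟩) push push)
        (ih (r + 1) (s + 1) u)) (by omega) (by simp; omega)
  have h₂ : ∀ (q r : ℕ) (u u' : List Unit),
      Exec (.loop .y fun _ => .push .x ())
        ⟨inp, out, u, u', un r, un q, j, t, a, cy, o⟩ (2 * q + 1)
        ⟨inp, out, u, u', un (r + q), [], j, t, a, cy, o⟩ := by
    intro q
    induction q with
    | zero => intro r u u'; exact loop_nil
    | succ q ih =>
      intro r u u'
      exact Exec.of (loop_cons (s₁ := ⟨inp, out, u, u', un r, un q, j, t, a, cy, o⟩) () (un q)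
        push (ih (r + 1) u u')) (by omega) (by simp; omega)
  have h₃ : ∀ (m s : ℕ),
      Exec (.loop .u fun _ => .seq (.loop .x fun _ => .seq (.push .y ()) (.push .u' ()))
          (.loop .y fun _ => .push .x ()))
        ⟨inp, out, un m, un s, un q, [], j, t, a, cy, o⟩ (m * (5 * q + 3) + 1)
        ⟨inp, out, [], un (s + m * q), un q, [], j, t, a, cy, o⟩ := by
    intro m
    induction m with
    | zero => intro s; exact Exec.of loop_nil (by simp) (by simp)
    | succ m ih =>
      intro s
      exact Exec.of (loop_cons (s₁ := ⟨inp, out, un m, un s, un q, [], j, t, a, cy, o⟩) () (un m)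
        (Exec.of (seq (h₁ q 0 s (un m)) (h₂ _ 0 _ _)) (t' := 5 * q + 2)
          (s'' := ⟨inp, out, un m, un (s + q), un q, [], j, t, a, cy, o⟩) (by omega) (by simp))
        (ih (s + q))) (by ring_nf; omega) (by simp; ring)
  have h₄ : ∀ (q r : ℕ) (x : List Unit),
      Exec (.loop .u' fun _ => .push .u ())
        ⟨inp, out, un r, un q, x, [], j, t, a, cy, o⟩ (2 * q + 1)
        ⟨inp, out, un (r + q), [], x, [], j, t, a, cy, o⟩ := by
    intro q
    induction q with
    | zero => intro r x; exact loop_nil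
    | succ q ih =>
      intro r x
      exact Exec.of (loop_cons (s₁ := ⟨inp, out, un r, un q, x, [], j, t, a, cy, o⟩) () (un q)
        push (ih (r + 1) x)) (by omega) (by simp; omega)
  exact Exec.of (seq (h₃ m 0) (h₄ _ 0 _)) (by ring_nf; omega) (by simp)

theorem exec_powX (c k q : ℕ) (hq : 0 < q) :
    Exec (powX k) ⟨inp, out, un c, [], un q, [], j, t, a, cy, o⟩
      (k * (c * q ^ k * (7 * q + 3) + 2) + 1)
      ⟨inp, out, un (c * q ^ k), [], un q, [], j, t, a, cy, o⟩ := by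
  induction k with
  | zero => exact Exec.of (skip _) (by simp) (by simp)
  | succ k ih =>
    refine Exec.of (seq ih (exec_mulX (c * q ^ k) q)) ?_ (by simp [pow_succ, mul_assoc])
    -- As `q` is positive, the last multiplication is the most expensive one and bounds all the
    -- others.
    have h : c * q ^ k * (7 * q + 3) ≤ c * q ^ (k + 1) * (7 * q + 3) :=
      Nat.mul_le_mul_right _ (Nat.mul_le_mul_left _ (Nat.pow_le_pow_right hq (by omega)))
    have h' : k * (c * q ^ k * (7 * q + 3) + 2) ≤ k * (c * q ^ (k + 1) * (7 * q + 3) + 2) :=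
      Nat.mul_le_mul_left _ (by omega)
    rw [Nat.succ_mul k]
    omega

theorem exec_addU (c : ℕ) :
    Exec (addU c) ⟨inp, out, [], u', x, y, j, t, a, cy, o⟩ (c + 1)
      ⟨inp, out, un c, u', x, y, j, t, a, cy, o⟩ := by
  induction c with
  | zero => exact skip _
  | succ c ih =>
    have h : Exec (.push .u ()) ⟨inp, out, un c, u', x, y, j, t, a, cy, o⟩ 1
      ⟨inp, out, un (c + 1), u', x, y, j, t, a, cy, o⟩ := push
    exact seq ih h

theorem exec_clearX (q : ℕ) :
    Exec (.loop .x fun _ => .skip) ⟨inp, out, u, u', un q, y, j, t, a, cy, o⟩ (2 * q + 1)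
      ⟨inp, out, u, u', [], y, j, t, a, cy, o⟩ := by
  induction q with
  | zero => exact loop_nil
  | succ q ih =>
    exact Exec.of (loop_cons (s₁ := ⟨inp, out, u, u', un q, y, j, t, a, cy, o⟩) () (un q)
      (skip _) ih) (by omega) rfl

theorem exec_clearJ (l : List Bool) :
    Exec (.loop .j fun _ => .skip) ⟨inp, out, u, u', x, y, l, t, a, cy, o⟩ (2 * l.length + 1)
      ⟨inp, out, u, u', x, y, [], t, a, cy, o⟩ := by
  induction l with
  | nil => exact loop_nil
  | cons b l ih =>
    exact Exec.of (loop_cons (s₁ := ⟨inp, out, u, u', x, y, l, t, a, cy, o⟩) b l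
      (skip _) ih) (by simp; omega) rfl

theorem exec_clearA (l : List Bool) :
    Exec (.loop .a fun _ => .skip) ⟨inp, out, u, u', x, y, j, t, l, cy, o⟩ (2 * l.length + 1)
      ⟨inp, out, u, u', x, y, j, t, [], cy, o⟩ := by
  induction l with
  | nil => exact loop_nil
  | cons b l ih =>
    exact Exec.of (loop_cons (s₁ := ⟨inp, out, u, u', x, y, j, t, l, cy, o⟩) b l
      (skip _) ih) (by simp; omega) rfl

theorem exec_flush (l : List Γ') :
    Exec (.loop .o fun g => .push .out g) ⟨inp, out, u, u', x, y, j, t, a, cy, l⟩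
      (2 * l.length + 1) ⟨inp, l.reverse ++ out, u, u', x, y, j, t, a, cy, []⟩ := by
  induction l generalizing out with
  | nil => exact loop_nil
  | cons g l ih =>
    exact Exec.of (loop_cons (s₁ := ⟨inp, out, u, u', x, y, j, t, a, cy, l⟩) g l
      push (ih (out := g :: out))) (by simp; omega) (by simp)

/-- Move the counter to the stack of the window. -/
def jToA : Prog :=
  .seq (.loop .j fun b => .push .t b) (.loop .t fun b => .push .a b)

theorem exec_jToA :
    Exec jToA ⟨inp, out, u, u', x, y, j, [], [], cy, o⟩ (4 * j.length + 2)
      ⟨inp, out, u, u', x, y, [], [], j, cy, o⟩ := by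
  have h : ∀ l t : List Bool, Exec (.loop .j fun b => .push .t b)
      ⟨inp, out, u, u', x, y, l, t, [], cy, o⟩ (2 * l.length + 1)
      ⟨inp, out, u, u', x, y, [], l.reverse ++ t, [], cy, o⟩ := by
    intro l
    induction l with
    | nil => intro t; exact loop_nil
    | cons b l ih =>
      intro t
      exact Exec.of (loop_cons (s₁ := ⟨inp, out, u, u', x, y, l, t, [], cy, o⟩) b l
        push (ih (b :: t))) (by simp; omega) (by simp)
  exact Exec.of (seq (h j []) (exec_unload_a _)) (by simp; omega) (by simp)

/-! ## Generation of an instance -/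

/-- The data of the generation: a polynomial `c * (n + 1) ^ k` and several templates. -/
structure Gen where
  c : ℕ
  k : ℕ
  pre : Template
  var : Template
  mid : Template
  first : Option Bool → Template
  rest : Option Bool → Template
  rule : Template
  post : Template

namespace Gen

variable (G : Gen)

/-- The number of positions, minus one. -/
def width (n : ℕ) : ℕ := G.c * (n + 1) ^ G.k

/-- The string that is generated. -/
def output (w : List Bool) : List Γ' :=
  let N := G.width w.length
  let a := encodeNat (N + 2)
  G.pre.fill [] [] ++ (G.var.fill (encodeNat 1) [] ++
    (((List.range N).flatMap fun d => G.var.fill (encodeNat (1 + d + 1)) []) ++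
    (G.var.fill (encodeNat 1) a ++ (G.mid.fill (encodeNat 1) a ++
    ((G.first w.head?).fill (encodeNat 1) a ++ (G.rule.fill (encodeNat 1) a ++
    (((List.range N).flatMap fun d => (G.rest w.tail[d]?).fill (encodeNat (1 + d + 1)) a ++
      G.rule.fill (encodeNat (1 + d + 1)) a) ++ G.post.fill (encodeNat (1 + N)) a)))))))

/-- The body of the first loop. -/
def varBody : Prog := .seq (.push .u' ()) (.seq incr (emit G.var))

/-- The body of the second loop. -/
def ruleBody : Prog :=
  .seq incr (.seq (.pop .inp fun b => emit (G.rest b)) (emit G.rule))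

/-- The program that generates the output. -/
def prog : Prog :=
  .seq loadX <| .seq (addU G.c) <| .seq (powX G.k) <| .seq (.loop .x fun _ => .skip) <|
  .seq (emit G.pre) <| .seq (.push .j true) <| .seq (emit G.var) <|
  .seq (.loop .u fun _ => G.varBody) <| .seq incr <| .seq jToA <| .seq (.push .j true) <|
  .seq (emit G.var) <| .seq (emit G.mid) <| .seq (.pop .inp fun b => emit (G.first b)) <|
  .seq (emit G.rule) <| .seq (.loop .u' fun _ => G.ruleBody) <| .seq (emit G.post) <|
  .seq (.loop .j fun _ => .skip) <| .seq (.loop .a fun _ => .skip) <|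
  .loop .o fun g => .push .out g

/-- A bound for the lengths of the templates. -/
def size : ℕ :=
  G.pre.length + G.var.length + G.mid.length + G.rule.length + G.post.length +
    ((G.first none).length + (G.first (some true)).length + (G.first (some false)).length) +
    ((G.rest none).length + (G.rest (some true)).length + (G.rest (some false)).length)

theorem length_first_le (b : Option Bool) : (G.first b).length ≤ G.size := by
  unfold size
  rcases b with _ | _ | _ <;> omega

theorem length_rest_le (b : Option Bool) : (G.rest b).length ≤ G.size := by
  unfold size
  rcases b with _ | _ | _ <;> omega

theorem exec_emit_le {m : Template} {L B : ℕ} (hm : m.length ≤ L) (hj : j.length ≤ B)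
    (ha : a.length ≤ B) :
    Exec (emit m) ⟨inp, out, u, u', x, y, j, [], a, cy, o⟩ (L * (10 * B + 2) + 1)
      ⟨inp, out, u, u', x, y, j, [], a, cy, (m.fill j a).reverse ++ o⟩ :=
  (exec_emit m).weaken (Nat.add_le_add_right (Nat.mul_le_mul hm (by omega)) 1)

theorem exec_pop_emit {f : Option Bool → Template} {L B : ℕ} (hm : ∀ b, (f b).length ≤ L)
    (hj : j.length ≤ B) (ha : a.length ≤ B) :
    Exec (.pop .inp fun b => emit (f b)) ⟨inp, out, u, u', x, y, j, [], a, cy, o⟩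
      (L * (10 * B + 2) + 1 + 1)
      ⟨inp.tail, out, u, u', x, y, j, [], a, cy, ((f inp.head?).fill j a).reverse ++ o⟩ :=
  pop inp.head? (s₁ := ⟨inp.tail, out, u, u', x, y, j, [], a, cy, o⟩)
    (exec_emit_le (hm _) hj ha)

theorem exec_pushJ :
    Exec (.push .j true) ⟨inp, out, u, u', x, y, [], t, a, cy, o⟩ 1
      ⟨inp, out, u, u', x, y, encodeNat 1, t, a, cy, o⟩ := by
  rw [encodeNat_one]
  exact push

/-- The units of `u` are handed over to `u'`, so that the second loop has as many rounds as the
first. A number has at most as many digits as its value, so `i + m ≤ B` bounds every counter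
printed. -/
theorem exec_varLoop {L B : ℕ} (hL : G.var.length ≤ L) (ha : a.length ≤ B) :
    ∀ (m i r : ℕ) (o : List Γ'), i + m ≤ B →
    Exec (.loop .u fun _ => G.varBody)
      ⟨inp, out, un m, un r, x, y, encodeNat i, [], a, [], o⟩
      (m * (L * (10 * B + 2) + 6 * B + 12) + 1)
      ⟨inp, out, [], un (r + m), x, y, encodeNat (i + m), [], a, [],
        ((List.range m).flatMap fun d => G.var.fill (encodeNat (i + d + 1)) a).reverse ++ o⟩ := by
  intro m
  induction m with
  | zero => intro i r o _; exact Exec.of loop_nil (by simp) (by simp)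
  | succ m ih =>
    intro i r o hB
    have h₁ : Exec (.push .u' ()) ⟨inp, out, un m, un r, x, y, encodeNat i, [], a, [], o⟩ 1
      ⟨inp, out, un m, un (r + 1), x, y, encodeNat i, [], a, [], o⟩ := push
    have hl := length_encodeNat_le i
    have hl' := length_encodeNat_le (i + 1)
    have h₂ := seq h₁ (seq exec_incr (exec_emit_le (o := o) hL
      (by rw [← encodeNat_succ]; omega : (binSucc (encodeNat i)).length ≤ B) ha))
    rw [← encodeNat_succ] at h₂
    refine Exec.of (loop_cons (s₁ := ⟨inp, out, un m, un r, x, y, encodeNat i, [], a, [], o⟩) ()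
      (un m) h₂ (ih (i + 1) (r + 1) _ (by omega))) (by ring_nf; omega) ?_
    simp only [List.range_succ_eq_map, List.flatMap_cons, List.flatMap_map, List.reverse_append,
      List.append_assoc, Nat.succ_eq_add_one, add_zero]
    simp only [add_comm, add_left_comm]

/-- One input bit is consumed per round. Popping the exhausted input yields `none`, which agrees
with `w[d]?` beyond the end of the word. -/
theorem exec_ruleLoop {L B : ℕ} (hL : G.size ≤ L) (ha : a.length ≤ B) :
    ∀ (m i : ℕ) (w : List Bool) (o : List Γ'), i + m ≤ B →
    Exec (.loop .u' fun _ => G.ruleBody)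
      ⟨w, out, u, un m, x, y, encodeNat i, [], a, [], o⟩
      (m * (2 * (L * (10 * B + 2)) + 6 * B + 14) + 1)
      ⟨w.drop m, out, u, [], x, y, encodeNat (i + m), [], a, [],
        ((List.range m).flatMap fun d => (G.rest w[d]?).fill (encodeNat (i + d + 1)) a ++
          G.rule.fill (encodeNat (i + d + 1)) a).reverse ++ o⟩ := by
  intro m
  induction m with
  | zero => intro i w o _; exact Exec.of loop_nil (by simp) (by simp)
  | succ m ih =>
    intro i w o hB
    have hl := length_encodeNat_le i
    have hl' := length_encodeNat_le (i + 1)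
    have hR : G.rule.length ≤ L := by unfold size at hL; omega
    have h₁ : Exec incr ⟨w, out, u, un m, x, y, encodeNat i, [], a, [], o⟩ (6 * B + 9)
        ⟨w, out, u, un m, x, y, encodeNat (i + 1), [], a, [], o⟩ := by
      rw [encodeNat_succ]
      exact exec_incr.weaken (by omega)
    have hb := fun b => (G.length_rest_le b).trans hL
    have h₃ := seq h₁ (seq (exec_pop_emit hb (by omega) ha) (exec_emit_le hR (by omega) ha))
    refine Exec.of (loop_cons (s₁ := ⟨w, out, u, un m, x, y, encodeNat i, [], a, [], o⟩) ()
      (un m) h₃ (ih (i + 1) _ _ (by omega))) (by ring_nf; omega) ?_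
    simp only [List.range_succ_eq_map, List.flatMap_cons, List.flatMap_map, List.reverse_append,
      List.append_assoc, Nat.succ_eq_add_one, add_zero, List.drop_tail, List.getElem?_tail,
      List.head?_eq_getElem?]
    simp only [add_comm, add_left_comm]

/-! ### Length of the output and running time -/

theorem length_fill_le {m : Template} {B : ℕ} (hB : 0 < B) (hj : j.length ≤ B)
    (ha : a.length ≤ B) : (m.fill j a).length ≤ m.length * B := by
  induction m with
  | nil => simp [Template.fill]
  | cons i m ih =>
    have h : (Template.fill j a (i :: m)).length ≤ B + (Template.fill j a m).length := by
      rcases i with g | _ | _ <;> simp [Template.fill] <;> omega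
    rw [List.length_cons, Nat.succ_mul m.length]
    omega

theorem length_flatMap_range_le {f : ℕ → List Γ'} {C N : ℕ} (h : ∀ d < N, (f d).length ≤ C) :
    ((List.range N).flatMap f).length ≤ N * C := by
  rw [List.length_flatMap]
  refine (List.sum_le_card_nsmul _ C ?_).trans (by simp)
  simpa using h

/-- The output is made of 3N + 7 filled templates, and each symbol or hole of a template contributes
at most N + 2 symbols. -/
theorem length_output_le (w : List Bool) :
    (G.output w).length ≤ (3 * G.width w.length + 8) * (G.size * (G.width w.length + 2)) := by
  unfold output
  set N := G.width w.length
  have hfill : ∀ (m : Template) (i : ℕ) (a : List Bool), m.length ≤ G.size → i ≤ N + 2 →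
      a.length ≤ N + 2 → (m.fill (encodeNat i) a).length ≤ G.size * (N + 2) :=
    fun m i a hm hi ha => (length_fill_le (by omega) ((length_encodeNat_le i).trans hi) ha).trans
      (Nat.mul_le_mul_right _ hm)
  have hsz : G.pre.length ≤ G.size ∧ G.var.length ≤ G.size ∧ G.mid.length ≤ G.size ∧
      G.rule.length ≤ G.size ∧ G.post.length ≤ G.size := by
    unfold size; omega
  obtain ⟨s₁, s₂, s₃, s₄, s₅⟩ := hsz
  have ha := length_encodeNat_le (N + 2)
  have h₀ := hfill G.pre 0 [] s₁ (by omega) (by simp)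
  have h₁ := hfill G.var 1 [] s₂ (by omega) (by simp)
  have h₂ := hfill G.var 1 _ s₂ (by omega) ha
  have h₃ := hfill G.mid 1 _ s₃ (by omega) ha
  have h₄ := hfill (G.first w.head?) 1 _ (G.length_first_le _) (by omega) ha
  have h₅ := hfill G.rule 1 _ s₄ (by omega) ha
  have h₆ := hfill G.post (1 + N) _ s₅ (by omega) ha
  have h₇ : ((List.range N).flatMap fun d => G.var.fill (encodeNat (1 + d + 1)) []).length ≤
      N * (G.size * (N + 2)) :=
    length_flatMap_range_le fun d hd => hfill G.var _ [] s₂ (by omega) (by simp)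
  have h₈ : ((List.range N).flatMap fun d =>
      (G.rest w.tail[d]?).fill (encodeNat (1 + d + 1)) (encodeNat (N + 2)) ++
        G.rule.fill (encodeNat (1 + d + 1)) (encodeNat (N + 2))).length ≤
      N * (2 * (G.size * (N + 2))) := by
    refine length_flatMap_range_le fun d hd => ?_
    have := hfill (G.rest w.tail[d]?) (1 + d + 1) _ (G.length_rest_le _) (by omega) ha
    have := hfill G.rule (1 + d + 1) _ s₄ (by omega) ha
    rw [List.length_append]
    omega
  rw [encodeNat_zero] at h₀
  simp only [List.length_append]
  generalize G.size * (N + 2) = C at *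
  have : N * (2 * C) = 2 * (N * C) := by ring
  have : (3 * N + 8) * C = 3 * (N * C) + 8 * C := by ring
  omega

/-- The running time on inputs of length `n`. -/
def time (n : ℕ) : ℕ :=
  let N := G.width n
  let E := G.size * (10 * (N + 2) + 2) + 1
  (5 * n + 3) + (G.c + 1) + (G.k * (G.c * (n + 1) ^ G.k * (7 * (n + 1) + 3) + 2) + 1) +
    (2 * (n + 1) + 1) + 7 * E + (N * (G.size * (10 * (N + 2) + 2) + 6 * (N + 2) + 12) + 1) +
    (N * (2 * (G.size * (10 * (N + 2) + 2)) + 6 * (N + 2) + 14) + 1) + (14 * (N + 2) + 17) +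
    (2 * ((3 * N + 8) * (G.size * (N + 2))) + 1)

/-- The costs of the commands of `prog`, in order, are regrouped as in `time`; with the nonlinear
summands replaced by variables this is linear arithmetic. -/
theorem time_bound (t n c E t₁ t₂ t₃ t₄ N a b : ℕ) (ha : a ≤ N + 2) (hb : b ≤ N + 2) :
    n + 3 + (c + 1 + (t₃ + 1 + (t₄ + 1 + (E + (1 + (E + (t₁ + 1 + (6 * (N + 2) + 9 +
      (4 * a + 2 + (1 + (E + (E + (E + 1 + (E + (t₂ + 1 + (E + (2 * b + 1 + (2 * a + 1 +
        (2 * t + 1))))))))))))))))))) ≤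
    n + 3 + (c + 1) + (t₃ + 1) + (t₄ + 1) + 7 * E + (t₁ + 1) + (t₂ + 1) + (14 * (N + 2) + 17) +
      (2 * t + 1) := by
  linarith

/-- The hypothesis makes the `N + 1` pops exhaust the input: at halting every stack but the output
must be empty. -/
theorem exec_prog (w : List Bool) (hw : w.length ≤ G.width w.length + 1) :
    Exec G.prog { inp := w } (G.time w.length) { out := G.output w } := by
  have hlen := G.length_output_le w
  unfold time
  set N := G.width w.length with hN
  set E := G.size * (10 * (N + 2) + 2) + 1 with hE
  set a := encodeNat (N + 2) with ha'
  have ha : a.length ≤ N + 2 := length_encodeNat_le _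
  have hsz : G.pre.length ≤ G.size ∧ G.var.length ≤ G.size ∧ G.mid.length ≤ G.size ∧
      G.rule.length ≤ G.size ∧ G.post.length ≤ G.size := by
    unfold size; omega
  obtain ⟨s₁, s₂, s₃, s₄, s₅⟩ := hsz
  have l₁ : (encodeNat 1).length ≤ N + 2 := (length_encodeNat_le 1).trans (by omega)
  have l₂ : (encodeNat (1 + N)).length ≤ N + 2 := (length_encodeNat_le _).trans (by omega)
  -- The first loop leaves N + 1 on the counter; one more increment produces the window N + 2.
  have hincr : ∀ o : List Γ', Exec incr
      ⟨w, [], [], un (0 + N), [], [], encodeNat (1 + N), [], [], [], o⟩ (6 * (N + 2) + 9)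
      ⟨w, [], [], un (0 + N), [], [], a, [], [], [], o⟩ := by
    intro o
    rw [ha', show N + 2 = (1 + N) + 1 by omega, encodeNat_succ]
    exact exec_incr.weaken (by omega)
  have hloop : ∀ (w : List Bool) (o : List Γ'), Exec (.loop .u' fun _ => G.ruleBody)
      ⟨w, [], [], un (0 + N), [], [], encodeNat 1, [], a, [], o⟩ _ _ := fun w o => by
    rw [Nat.zero_add]
    exact G.exec_ruleLoop le_rfl ha N 1 w o (by omega)
  have hflush : ∀ (i : List Bool) (l : List Γ'), i = [] → l = (G.output w).reverse →
      Exec (.loop .o fun g => .push .out g) ⟨i, [], [], [], [], [], [], [], [], [], l⟩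
        (2 * ((3 * N + 8) * (G.size * (N + 2))) + 1) { out := G.output w } := by
    rintro i l rfl rfl
    exact Exec.of (exec_flush _) (by rw [List.length_reverse]; omega) (by simp)
  have hd : w.tail.drop N = [] := by
    rw [List.drop_eq_nil_iff, List.length_tail]; omega
  have h := seq (exec_loadX (inp := w) (out := []) (u := []) (u' := []) (y := []) (j := [])
      (a := []) (cy := []) (o := [])) <|
    seq (exec_addU G.c) <| seq (exec_powX G.c G.k (w.length + 1) (by omega)) <|
    seq (exec_clearX (w.length + 1)) <|
    seq (exec_emit_le (B := N + 2) s₁ (by simp) (by simp)) <| seq exec_pushJ <|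
    seq (exec_emit_le s₂ l₁ (by simp)) <|
    seq (G.exec_varLoop (B := N + 2) s₂ (by simp) N 1 0 _ (by omega)) <| seq (hincr _) <| seq exec_jToA <|
    seq exec_pushJ <| seq (exec_emit_le s₂ l₁ ha) <| seq (exec_emit_le s₃ l₁ ha) <|
    seq (exec_pop_emit G.length_first_le l₁ ha) <| seq (exec_emit_le s₄ l₁ ha) <|
    seq (hloop _ _) <| seq (exec_emit_le s₅ l₂ ha) <| seq (exec_clearJ _) <|
    seq (exec_clearA _) (hflush _ _ hd (by
      simp only [← List.reverse_append, List.append_nil, List.append_assoc, output]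
      rfl))
  refine h.weaken ?_
  exact time_bound _ _ _ _ _ _ _ _ _ _ _ ha l₂

/-- The memory at the start. -/
theorem get_input (w : List Bool) :
    Mem.get { inp := w } = Function.update (fun k => ([] : List (Stk.Sym k))) Stk.inp w := by
  funext k; cases k <;> simp [Mem.get]

/-- The memory at the end. -/
theorem get_output (l : List Γ') :
    Mem.get { out := l } = Function.update (fun k => ([] : List (Stk.Sym k))) Stk.out l := by
  funext k; cases k <;> simp [Mem.get]

/-- A polynomial that bounds the running time. -/
noncomputable def timePoly : Polynomial ℕ :=
  let n : Polynomial ℕ := Polynomial.X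
  let N : Polynomial ℕ := G.c * (n + 1) ^ G.k
  let E : Polynomial ℕ := G.size * (10 * (N + 2) + 2) + 1
  (5 * n + 3) + (G.c + 1) + (G.k * (G.c * (n + 1) ^ G.k * (7 * (n + 1) + 3) + 2) + 1) +
    (2 * (n + 1) + 1) + 7 * E + (N * (G.size * (10 * (N + 2) + 2) + 6 * (N + 2) + 12) + 1) +
    (N * (2 * (G.size * (10 * (N + 2) + 2)) + 6 * (N + 2) + 14) + 1) + (14 * (N + 2) + 17) +
    (2 * ((3 * N + 8) * (G.size * (N + 2))) + 1) + 1

theorem eval_timePoly (n : ℕ) : G.timePoly.eval n = G.time n + 1 := by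
  simp [timePoly, time, width]

/-- The generated string is computed in polynomial time. -/
theorem computable {α : Type} (e : α → List Γ') (f : List Bool → α)
    (hw : ∀ n, n ≤ G.width n + 1) (hf : ∀ w, e (f w) = G.output w) :
    Nonempty (Turing.TM2ComputableInPolyTime (encodingList Bool).encode e f) := by
  have h : ∀ w : List Bool, Nonempty (Turing.TM2OutputsInTime
      (Cmd.machine G.prog Stk.inp Stk.out) w (some (e (f w))) (G.timePoly.eval w.length)) := by
    intro w
    rw [eval_timePoly, hf]
    apply Cmd.outputsInTime_machine
    rw [← get_input, ← get_output]
    exact G.exec_prog w (hw _)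
  refine ⟨⟨⟨Cmd.machine G.prog Stk.inp Stk.out, Equiv.refl Bool, Equiv.refl Γ'⟩, G.timePoly, ?_⟩⟩
  intro w
  have hw := (h w).some
  -- The two alphabet equivalences are identities, but mapping the identity over a list is the list
  -- only up to a propositional equality.
  refine cast ?_ hw
  congr 1
  · exact (List.map_id _).symm
  · exact congrArg some (List.map_id _).symm

end Gen

end TP

namespace TP

/-! ## Cyclic tile sequences as timelines -/

/-- A tile system with tiles `0, …, C - 1`: the tiles that may follow a tile in a sequence, those
that may stand one period later, and the tiles at which a sequence may stop. -/
structure TileSys (C : ℕ) where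
  next : Fin C → List (Fin C)
  later : Fin C → List (Fin C)
  final : Fin C → Bool

namespace TileSys

variable {C : ℕ}

/-- There is a finite sequence of tiles, beginning with `ini 0, …, ini (N - 1)`, in which each tile
that is not final is followed, `N` places later, by one that is allowed there. -/
def Solvable (T : TileSys C) (N : ℕ) (ini : ℕ → Fin C) : Prop :=
  ∃ (L : ℕ) (t : ℕ → Fin C), N ≤ L ∧ (∀ i < N, t i = ini i) ∧
    (∀ i, i + 1 < L → t (i + 1) ∈ T.next (t i)) ∧
    ∀ i < L, T.final (t i) = true ∨ (i + N < L ∧ t (i + N) ∈ T.later (t i))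

/-- The value for the tile `c` at position `j`; position `0` is not used. -/
def pack {M : ℕ} (j : Fin (M + 2)) (c : Fin C) : Fin ((M + 2) * C) := finProdFinEquiv (j, c)

/-- The cyclic order of the positions `1, …, M + 1`. -/
def nextPos {M : ℕ} (j : Fin (M + 2)) : Fin (M + 2) :=
  if h : j.val < M + 1 then ⟨j.val + 1, by omega⟩ else ⟨1, by omega⟩

/-- The state variable whose timelines are sequences of tiles at cyclic positions. -/
def stateVar (T : TileSys C) (M : ℕ) : StateVar where
  size := (M + 2) * C
  succs v := (T.next (finProdFinEquiv.symm v).2).map (pack (nextPos (finProdFinEquiv.symm v).1))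
  dur _ := Intv.fromTo 1

/-- The single state variable, as a family. -/
abbrev vars (T : TileSys C) (M : ℕ) : Fin 1 → StateVar := fun _ => T.stateVar M

/-- Position `i + 1` has the tile `c` at the time `i`. -/
def iniRule (T : TileSys C) (M : ℕ) (i : Fin (M + 1)) (c : Fin C) : Rule (T.vars M) :=
  .triggerless [⟨[⟨0, 0, pack i.succ c⟩], [.lePoint 0 .finish (Intv.zeroTo 1) (i + 1)]⟩]

/-- What has to follow the tile `c` at position `i + 1`. -/
def tileRule (T : TileSys C) (M : ℕ) (i : Fin (M + 1)) (c : Fin C) : Rule (T.vars M) :=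
  .trigger ⟨0, 0, pack i.succ c⟩
    (if T.final c then [⟨[], []⟩] else (T.later c).map fun c' =>
      ⟨[⟨1, 0, pack i.succ c'⟩], [.interval 0 .finish (Intv.zeroTo (M + 2)) .start 1]⟩)

/-- All the rules. -/
def ruleList (T : TileSys C) (M : ℕ) (ini : ℕ → Fin C) : List (Rule (T.vars M)) :=
  (List.finRange (M + 1)).flatMap fun i =>
    T.iniRule M i (ini i) :: (List.finRange C).map (T.tileRule M i)

/-- The TP domain that expresses solvability with the period `M + 1`. -/
def domain (T : TileSys C) (M : ℕ) (ini : ℕ → Fin C) : Domain where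
  numVars := 1
  var := T.vars M
  rules := T.ruleList M ini

/-! ### Syntactic restrictions satisfied by the domain -/

variable (T : TileSys C) (M : ℕ) (ini : ℕ → Fin C)

theorem mem_ruleList {R : Rule (T.vars M)} : R ∈ T.ruleList M ini ↔
    ∃ i : Fin (M + 1), R = T.iniRule M i (ini i) ∨ ∃ c, R = T.tileRule M i c := by
  simp only [ruleList, List.mem_flatMap, List.mem_finRange, true_and, List.mem_cons, List.mem_map]
  simp only [eq_comm]

theorem isSimple_iniRule (i : Fin (M + 1)) (c : Fin C) :
    (T.iniRule M i c).WellFormed ∧ (T.iniRule M i c).SimpleIfTrigger := by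
  simp [Rule.WellFormed, Rule.SimpleIfTrigger, iniRule, Atom.names]

theorem isSimple_tileRule (i : Fin (M + 1)) (c : Fin C) :
    (T.tileRule M i c).WellFormed ∧ (T.tileRule M i c).SimpleIfTrigger := by
  constructor
  · intro E hE a ha o ho
    split_ifs at hE with hc
    · simp only [List.mem_singleton] at hE
      subst hE
      simp at ha
    · simp only [List.mem_map] at hE
      obtain ⟨c', -, rfl⟩ := hE
      simp only [List.mem_singleton] at ha
      subst ha
      simpa [Atom.names, eq_comm] using ho
  · intro E hE o ho
    refine List.countP_le_length.trans ?_
    split_ifs at hE with hc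
    · simp only [List.mem_singleton] at hE
      subst hE
      simp
    · simp only [List.mem_map] at hE
      obtain ⟨c', -, rfl⟩ := hE
      simp

theorem isSimple_domain : (T.domain M ini).IsSimple := by
  intro R hR
  obtain ⟨i, h | ⟨c, h⟩⟩ := (T.mem_ruleList M ini).1 hR
  · exact h ▸ T.isSimple_iniRule M i _
  · exact h ▸ T.isSimple_tileRule M i c

theorem atomsZeroTo_iniRule (i : Fin (M + 1)) (c : Fin C) : ∀ E ∈ (T.iniRule M i c).body,
    ∀ a ∈ E.atoms, ∃ n : ℕ, 0 < n ∧ a.intv = Intv.zeroTo n := by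
  intro E hE a ha
  simp only [iniRule, Rule.body, List.mem_singleton] at hE
  subst hE
  simp only [List.mem_singleton] at ha
  subst ha
  exact ⟨1, one_pos, rfl⟩

theorem atomsZeroTo_tileRule (i : Fin (M + 1)) (c : Fin C) : ∀ E ∈ (T.tileRule M i c).body,
    ∀ a ∈ E.atoms, ∃ n : ℕ, 0 < n ∧ a.intv = Intv.zeroTo n := by
  intro E hE a ha
  simp only [tileRule, Rule.body] at hE
  split_ifs at hE with hc
  · simp only [List.mem_singleton] at hE
    subst hE
    simp at ha
  · simp only [List.mem_map] at hE
    obtain ⟨c', -, rfl⟩ := hE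
    simp only [List.mem_singleton] at ha
    subst ha
    exact ⟨M + 2, by omega, rfl⟩

theorem atomsZeroTo_domain : (T.domain M ini).AtomsZeroTo := by
  intro R hR
  obtain ⟨i, h | ⟨c, h⟩⟩ := (T.mem_ruleList M ini).1 hR
  · exact h ▸ T.atomsZeroTo_iniRule M i _
  · exact h ▸ T.atomsZeroTo_tileRule M i c

theorem durations_domain : (T.domain M ini).DurationsZeroToOrFrom :=
  fun _ _ => Or.inr ⟨1, rfl⟩

variable {T M ini}

theorem pack_inj {j j' : Fin (M + 2)} {c c' : Fin C} :
    pack j c = pack j' c' ↔ j = j' ∧ c = c' := by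
  simp [pack]

theorem pack_mem_succs {j j' : Fin (M + 2)} {c c' : Fin C} :
    pack j' c' ∈ (T.stateVar M).succs (pack j c) ↔ j' = nextPos j ∧ c' ∈ T.next c := by
  change (pack j' c' : Fin ((M + 2) * C)) ∈ (T.next (finProdFinEquiv.symm (pack j c)).2).map
    (pack (nextPos (finProdFinEquiv.symm (pack j c)).1)) ↔ _
  simp only [pack, Equiv.symm_apply_apply, List.mem_map, EmbeddingLike.apply_eq_iff_eq,
    Prod.mk.injEq]
  constructor
  · rintro ⟨a, h₁, h₂, rfl⟩; exact ⟨h₂.symm, h₁⟩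
  · rintro ⟨h₁, h₂⟩; exact ⟨_, h₂, h₁.symm, rfl⟩

/-- The position of the `i`-th token. -/
def posAt (M i : ℕ) : Fin (M + 2) :=
  ⟨i % (M + 1) + 1, by have := Nat.mod_lt i (show 0 < M + 1 by omega); omega⟩

theorem nextPos_posAt (i : ℕ) : nextPos (posAt M i) = posAt M (i + 1) := by
  have h := Nat.mod_lt i (show 0 < M + 1 by omega)
  have h₂ : (i + 1) % (M + 1) = if i % (M + 1) < M then i % (M + 1) + 1 else 0 := by
    rw [← Nat.mod_add_mod]
    split_ifs with h₃
    · exact Nat.mod_eq_of_lt (by omega)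
    · rw [show i % (M + 1) + 1 = M + 1 by omega, Nat.mod_self]
  unfold nextPos
  by_cases h₃ : i % (M + 1) < M
  · rw [dif_pos (show (posAt M i).val < M + 1 by simp only [posAt]; omega)]
    simp only [posAt, h₂, if_pos h₃]
  · rw [dif_neg (show ¬ (posAt M i).val < M + 1 by simp only [posAt]; omega)]
    simp only [posAt, h₂, if_neg h₃]

/-! ### From a timeline to a sequence of tiles -/

section

variable {x : StateVar} (π : Timeline x)

theorem time_finish (i : ℕ) : π.time i .finish = π.time (i + 1) .start := rfl

theorem time_start_zero : π.time 0 .start = 0 := by simp [Timeline.time]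

theorem time_start_succ {i : ℕ} (h : i < π.tokens.length) :
    π.time (i + 1) .start = π.time i .start + π.tokens[i].2 := by
  simp only [Timeline.time]
  rw [List.take_add_one, List.getElem?_eq_getElem h, Option.toList_some, List.map_append,
    List.sum_append, NNReal.coe_add]
  simp only [List.map_cons, List.map_nil, List.sum_cons, List.sum_nil, add_zero]

/-- Durations of at least 1 let elapsed time bound the number of tokens. Every counting argument
about timelines goes through this inequality. -/
theorem time_start_add (h : ∀ tk ∈ π.tokens, (1 : ℝ) ≤ tk.2) (i k : ℕ)
    (hk : i + k ≤ π.tokens.length) : π.time i .start + k ≤ π.time (i + k) .start := by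
  induction k with
  | zero => simp
  | succ k ih =>
    have h₁ := ih (by omega)
    have h₂ := h _ (List.getElem_mem (show i + k < π.tokens.length by omega))
    rw [← add_assoc, time_start_succ π (by omega)]
    push_cast
    linarith

end

theorem one_le_dur (π : Timeline (T.stateVar M)) : ∀ tk ∈ π.tokens, (1 : ℝ) ≤ tk.2 := by
  intro tk htk
  have h := (π.dur_mem tk htk).1
  simpa [stateVar, Intv.fromTo] using h

theorem mem_zeroTo {n : ℕ} {r : ℝ} : r ∈ (Intv.zeroTo n).toSet ↔ 0 ≤ r ∧ r ≤ n := by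
  simp [Intv.toSet, Intv.zeroTo]

theorem mem_fromTo {n : ℕ} {r : ℝ} : r ∈ (Intv.fromTo n).toSet ↔ n ≤ r := by
  simp [Intv.toSet, Intv.fromTo]

/-- The time of a token of a multi-timeline. -/
def tokenTime {m : ℕ} {X : Fin m → StateVar} (𝓣 : MultiTimeline X) (tk : Token 𝓣)
    (e : Endpoint) : ℝ := (𝓣 tk.1).time tk.2 e

theorem sat_interval {m : ℕ} {X : Fin m → StateVar} {𝓣 : MultiTimeline X} {asg : ℕ → Token 𝓣}
    {o₁ o₂ : ℕ} {e₁ e₂ : Endpoint} {I : Intv} : Atom.Sat 𝓣 asg (.interval o₁ e₁ I e₂ o₂) ↔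
      tokenTime 𝓣 (asg o₂) e₂ - tokenTime 𝓣 (asg o₁) e₁ ∈ I.toSet := Iff.rfl

theorem sat_lePoint {m : ℕ} {X : Fin m → StateVar} {𝓣 : MultiTimeline X} {asg : ℕ → Token 𝓣}
    {o n : ℕ} {e : Endpoint} {I : Intv} : Atom.Sat 𝓣 asg (.lePoint o e I n) ↔
      (n : ℝ) - tokenTime 𝓣 (asg o) e ∈ I.toSet := Iff.rfl

/-- The interval `[0, 1]` counted back from `i + 1` confines the end time to between `i` and `i +
1`. The upper bound is what later locates the token. -/
theorem sat_iniRule {i : Fin (M + 1)} {c : Fin C} {𝓣 : MultiTimeline (T.vars M)} :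
    (T.iniRule M i c).Sat 𝓣 ↔ ∃ (k : ℕ) (h : k < (𝓣 0).tokens.length),
      ((𝓣 0).tokens[k]).1 = pack i.succ c ∧
      (i : ℝ) ≤ (𝓣 0).time (k + 1) .start ∧ (𝓣 0).time (k + 1) .start ≤ i + 1 := by
  constructor
  · rintro ⟨E, hE, asg, h₁, h₂⟩
    simp only [List.mem_singleton] at hE
    subst hE
    obtain ⟨⟨k, hk⟩, h₃, h₄⟩ := h₁ _ (List.mem_singleton_self _)
    have h₅ := h₂ _ (List.mem_singleton_self _)
    replace h₃ : asg 0 = ⟨0, k, hk⟩ := h₃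
    rw [sat_lePoint, h₃, tokenTime, time_finish, mem_zeroTo] at h₅
    push_cast at h₅
    exact ⟨k, hk, h₄, by linarith [h₅.2], by linarith [h₅.1]⟩
  · rintro ⟨k, hk, h₁, h₂, h₃⟩
    refine ⟨_, List.mem_singleton_self _, fun _ => ⟨0, k, hk⟩, ?_, ?_⟩
    · intro q hq
      simp only [List.mem_singleton] at hq
      subst hq
      exact ⟨⟨k, hk⟩, rfl, h₁⟩
    · intro a ha
      simp only [List.mem_singleton] at ha
      subst ha
      rw [sat_lePoint, tokenTime, time_finish, mem_zeroTo]
      push_cast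
      constructor <;> linarith

/-- For a final tile the body is the empty statement, which always holds. The last conjunct is the
atom added by the future semantics; the atom from the end of the trigger already implies it. -/
theorem sat_tileRule {i : Fin (M + 1)} {c : Fin C} {𝓣 : MultiTimeline (T.vars M)} :
    (T.tileRule M i c).future.Sat 𝓣 ↔
      ∀ (k : ℕ) (h : k < (𝓣 0).tokens.length), ((𝓣 0).tokens[k]).1 = pack i.succ c →
      T.final c = true ∨ ∃ (l : ℕ) (h : l < (𝓣 0).tokens.length), ∃ c' ∈ T.later c,
        ((𝓣 0).tokens[l]).1 = pack i.succ c' ∧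
        (𝓣 0).time (k + 1) .start ≤ (𝓣 0).time l .start ∧
        (𝓣 0).time l .start ≤ (𝓣 0).time (k + 1) .start + (M + 2) ∧
        (𝓣 0).time k .start ≤ (𝓣 0).time l .start := by
  constructor
  · intro h k hk hv
    obtain ⟨E, hE, asg, h₀, h₁, h₂⟩ := h ⟨k, hk⟩ hv
    split_ifs at hE with hc
    · exact Or.inl hc
    · simp only [List.map_map, List.mem_map, Function.comp_apply] at hE
      obtain ⟨c', hc', rfl⟩ := hE
      obtain ⟨⟨l, hl⟩, h₃, h₄⟩ := h₁ _ (List.mem_singleton_self _)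
      have h₅ := h₂ _ (List.mem_append_left _ (List.mem_singleton_self _))
      have h₆ := h₂ (Atom.interval 0 .start (Intv.fromTo 0) .start 1)
        (List.mem_append_right _ (List.mem_singleton_self _))
      replace h₀ : asg 0 = ⟨0, k, hk⟩ := h₀
      replace h₃ : asg 1 = ⟨0, l, hl⟩ := h₃
      rw [sat_interval, h₃, h₀, tokenTime, tokenTime, time_finish, mem_zeroTo] at h₅
      rw [sat_interval, h₃, h₀, tokenTime, tokenTime, mem_fromTo] at h₆
      push_cast at h₅ h₆
      refine Or.inr ⟨l, hl, c', hc', h₄, ?_, ?_, ?_⟩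
      · linarith [h₅.1]
      · linarith [h₅.2]
      · linarith
  · rintro h ⟨k, hk⟩ hv
    rcases h k hk hv with hc | ⟨l, hl, c', hc', h₁, h₂, h₃, h₄⟩
    · simp only [hc, if_true]
      refine ⟨_, List.mem_singleton_self _, fun _ => ⟨0, k, hk⟩, rfl, ?_, ?_⟩ <;> simp
    · by_cases hc : T.final c = true
      · simp only [hc, if_true]
        refine ⟨_, List.mem_singleton_self _, fun _ => ⟨0, k, hk⟩, rfl, ?_, ?_⟩ <;> simp
      · simp only [hc]
        refine ⟨_, List.mem_map_of_mem (List.mem_map_of_mem hc'),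
          fun n => if n = 0 then ⟨0, k, hk⟩ else ⟨0, l, hl⟩, rfl, ?_, ?_⟩
        · intro q hq
          simp only [List.mem_singleton] at hq
          subst hq
          exact ⟨⟨l, hl⟩, rfl, h₁⟩
        · intro a ha
          simp only [List.map_cons, List.map_nil, List.mem_append, List.mem_singleton] at ha
          rcases ha with rfl | rfl
          · rw [sat_interval, if_pos rfl, if_neg one_ne_zero, tokenTime, tokenTime, time_finish,
              mem_zeroTo]
            push_cast
            constructor <;> linarith
          · rw [sat_interval, if_pos rfl, if_neg one_ne_zero, tokenTime, tokenTime, mem_fromTo]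
            push_cast
            linarith

theorem hasFuturePlan_iff {𝓣 : MultiTimeline (T.vars M)} :
    (T.domain M ini).IsFuturePlan 𝓣 ↔
      ∀ i : Fin (M + 1), (T.iniRule M i (ini i)).Sat 𝓣 ∧ ∀ c, (T.tileRule M i c).future.Sat 𝓣 := by
  constructor
  · intro h i
    exact ⟨h _ ((T.mem_ruleList M ini).2 ⟨i, Or.inl rfl⟩),
      fun c => h _ ((T.mem_ruleList M ini).2 ⟨i, Or.inr ⟨c, rfl⟩⟩)⟩
  · intro h R hR
    obtain ⟨i, h' | ⟨c, h'⟩⟩ := (T.mem_ruleList M ini).1 hR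
    · subst h'; exact (h i).1
    · subst h'; exact (h i).2 c

/-- The successive tokens spell the sequence of tiles. Positions advance cyclically, so the `k`-th
token sits at position `k % (M + 1) + 1`, and the position of a token that a rule asks for fixes its
index modulo the period. The time bound and `2 ≤ M` then fix the index itself. -/
theorem Solvable.of_timeline (hM : 2 ≤ M) {𝓣 : MultiTimeline (T.vars M)}
    (h : (T.domain M ini).IsFuturePlan 𝓣) : T.Solvable (M + 1) ini := by
  rw [hasFuturePlan_iff] at h
  set π := 𝓣 0 with hπ
  have hdur := one_le_dur π
  have hlow : ∀ k < π.tokens.length, (k : ℝ) + 1 ≤ π.time (k + 1) .start := by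
    intro k hk
    have := time_start_add π hdur 0 (k + 1) (by omega)
    rw [time_start_zero, Nat.zero_add] at this
    push_cast at this
    linarith
  -- The `k`-th token ends no earlier than `k + 1`, so one that ends by `i + 1` has index at most
  -- `i`.
  have hini : ∀ i : Fin (M + 1), ∃ (k : ℕ) (hk : k < π.tokens.length), k ≤ i ∧
      π.tokens[k].1 = pack i.succ (ini i) := by
    intro i
    obtain ⟨k, hk, h₁, -, h₃⟩ := sat_iniRule.1 (h i).1
    refine ⟨k, hk, ?_, h₁⟩
    have := (hlow k hk).trans h₃
    exact_mod_cast (by linarith : (k : ℝ) ≤ i)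
  have hval : ∀ k (hk : k < π.tokens.length), ∃ c, π.tokens[k].1 = pack (posAt M k) c := by
    intro k
    induction k with
    | zero =>
      intro hk
      -- An index at most 0 is 0: the first initial rule makes the timeline begin at position 1.
      obtain ⟨k, hk', hk0, h₁⟩ := hini 0
      have : k = 0 := by simpa using hk0
      subst this
      refine ⟨_, h₁.trans (congrArg (fun j => pack j _) ?_)⟩
      ext
      simp [posAt]
    | succ k ih =>
      intro hk
      obtain ⟨c, hc⟩ := ih (by omega)
      have h₁ := π.chain k hk
      rw [hc] at h₁
      obtain ⟨⟨j, c'⟩, hjc⟩ := finProdFinEquiv.surjective (π.tokens[k + 1].1 : Fin ((M + 2) * C))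
      have h₂ : π.tokens[k + 1].1 = pack j c' := hjc.symm
      rw [h₂] at h₁
      replace h₁ := pack_mem_succs.1 h₁
      exact ⟨c', by rw [h₂, h₁.1, nextPos_posAt]⟩
  choose t ht using hval
  have hL : ∀ i : Fin (M + 1), ∃ hk : i.val < π.tokens.length, t i hk = ini i := by
    intro i
    obtain ⟨k, hk, h₁, h₂⟩ := hini i
    have h₃ := ht k hk
    rw [h₂] at h₃
    replace h₃ := pack_inj.1 h₃
    have h₄ := congrArg Fin.val h₃.1
    simp only [posAt, Fin.val_succ, Nat.mod_eq_of_lt (show k < M + 1 by omega)] at h₄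
    have h₅ : k = i := by omega
    subst h₅
    exact ⟨hk, h₃.2.symm⟩
  refine ⟨π.tokens.length, fun k => if hk : k < π.tokens.length then t k hk else ini 0, ?_, ?_, ?_,
    ?_⟩
  · exact (hL (Fin.last M)).1
  · intro i hi
    obtain ⟨hk, e⟩ := hL ⟨i, hi⟩
    exact (dif_pos hk).trans e
  · intro k hk
    have h₁ := π.chain k hk
    rw [ht k (by omega), ht (k + 1) hk] at h₁
    replace h₁ := pack_mem_succs.1 h₁
    beta_reduce
    rw [dif_pos hk, dif_pos (by omega)]
    exact h₁.2
  · intro k hk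
    beta_reduce
    rw [dif_pos hk]
    have hmod := Nat.mod_lt k (show 0 < M + 1 by omega)
    have h₁ := sat_tileRule.1 ((h ⟨k % (M + 1), hmod⟩).2 (t k hk)) k hk (ht k hk)
    refine h₁.imp_right ?_
    rintro ⟨l, hl, c', hc', h₂, h₃, h₄, -⟩
    change l < π.tokens.length at hl
    change π.tokens[l].1 = _ at h₂
    rw [← hπ] at h₃ h₄
    -- Tokens have positive length, so one that starts after the end of the `k`-th token has a
    -- larger index.
    have hkl : k + 1 ≤ l := by
      by_contra hlt
      obtain ⟨d, hd⟩ := Nat.exists_eq_add_of_le (show l ≤ k by omega)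
      have h₅ := time_start_add π hdur l (d + 1) (by omega)
      rw [show l + (d + 1) = k + 1 by omega] at h₅
      push_cast at h₅
      have : (0 : ℝ) ≤ d := Nat.cast_nonneg d
      linarith
    obtain ⟨d, rfl⟩ := Nat.exists_eq_add_of_le hkl
    have h₅ := time_start_add π hdur (k + 1) d (by omega)
    have hd : d ≤ M + 2 := by exact_mod_cast (by linarith : (d : ℝ) ≤ M + 2)
    have h₆ := ht (k + 1 + d) hl
    rw [h₂] at h₆
    replace h₆ := pack_inj.1 h₆
    have h₇ : k % (M + 1) = (k + 1 + d) % (M + 1) := by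
      have := congrArg Fin.val h₆.1
      simpa [posAt] using this
    have h₈ : M + 1 ∣ 1 + d := by
      have := (Nat.modEq_iff_dvd' (show k ≤ k + 1 + d by omega)).1 h₇
      rwa [show k + 1 + d - k = 1 + d by omega] at this
    obtain ⟨q, hq⟩ := h₈
    -- Here `1 + d` is a positive multiple of `M + 1` and at most `M + 3`, which is less than `2 *
    -- (M + 1)` because `2 ≤ M`.
    have h₉ : q = 1 := by
      rcases q with _ | _ | q
      · omega
      · rfl
      · have : (M + 1) * (q + 1 + 1) = (M + 1) * q + 2 * (M + 1) := by ring
        have : 0 ≤ (M + 1) * q := Nat.zero_le _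
        omega
    have h₁₀ : k + 1 + d = k + (M + 1) := by rw [h₉] at hq; omega
    rw [← h₁₀]
    refine ⟨hl, ?_⟩
    rw [dif_pos hl, ← h₆.2]
    exact hc'

/-! ### From a sequence of tiles to a timeline -/

/-- The timeline of a sequence of tiles, with tokens of duration `1`. -/
def timeline (T : TileSys C) (M L : ℕ) (t : ℕ → Fin C) (hL : 0 < L)
    (ht : ∀ i, i + 1 < L → t (i + 1) ∈ T.next (t i)) : Timeline (T.stateVar M) where
  tokens := (List.range L).map fun i => ((pack (posAt M i) (t i) : Fin ((M + 2) * C)), (1 : ℝ≥0))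
  ne_nil := by simp; omega
  dur_mem tk htk := by
    simp only [List.mem_map] at htk
    obtain ⟨i, -, rfl⟩ := htk
    simp [stateVar, mem_fromTo]
  chain i hi := by
    simp only [List.getElem_map, List.getElem_range]
    refine pack_mem_succs.2 ⟨(nextPos_posAt i).symm, ht i ?_⟩
    simpa using hi

/-- With unit tokens the `i`-th token starts at time `i`. The tile one period later starts `M` after
the end of the trigger, inside the window `[0, M + 2]`. -/
theorem Solvable.exists_timeline (h : T.Solvable (M + 1) ini) :
    (T.domain M ini).HasFuturePlan := by
  obtain ⟨L, t, hL, hini, hnext, hlater⟩ := h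
  obtain ⟨π, hlen, hget, htime⟩ : ∃ π : Timeline (T.stateVar M), π.tokens.length = L ∧
      (∀ i (hi : i < π.tokens.length), π.tokens[i].1 = pack (posAt M i) (t i)) ∧
      ∀ i ≤ L, π.time i .start = i := by
    refine ⟨T.timeline M L t (by omega) hnext, by simp [timeline], fun i hi => ?_, fun i hi => ?_⟩
    · simp only [timeline, List.getElem_map, List.getElem_range]
      rfl
    · simp only [Timeline.time, timeline]
      rw [← List.map_take, List.map_map, List.take_range, Nat.min_eq_left hi]
      simp [Function.comp_def]
  refine ⟨fun _ => π, hasFuturePlan_iff.2 fun i => ⟨sat_iniRule.2 ?_, fun c =>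
    sat_tileRule.2 ?_⟩⟩
  · refine ⟨i, by omega, ?_, ?_, ?_⟩
    · rw [hget, hini i i.2]
      congr 1
      ext
      simp [posAt, Nat.mod_eq_of_lt i.2]
    · rw [htime _ (by omega)]; push_cast; linarith
    · rw [htime _ (by omega)]; push_cast; linarith
  · intro k hk hv
    rw [hget] at hv
    obtain ⟨hpos, rfl⟩ := pack_inj.1 hv
    refine (hlater k (by omega)).imp_right ?_
    rintro ⟨h₁, h₂⟩
    refine ⟨k + (M + 1), by omega, _, h₂, ?_, ?_, ?_, ?_⟩
    · rw [hget, ← hpos]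
      congr 1
      ext
      simp [posAt]
    all_goals
      simp only [htime _ (show k ≤ L by omega), htime _ (show k + 1 ≤ L by omega),
        htime _ h₁.le]
      push_cast
      have : (0 : ℝ) ≤ M := Nat.cast_nonneg M
      linarith

/-- The TP domain is a positive instance if and only if the tile system is solvable. -/
theorem hasFuturePlan_domain_iff (hM : 2 ≤ M) :
    (T.domain M ini).HasFuturePlan ↔ T.Solvable (M + 1) ini :=
  ⟨fun ⟨_, h⟩ => Solvable.of_timeline hM h, Solvable.exists_timeline⟩

end TileSys

end TP

namespace TP

open Computability

/-! ## The code of the generated domain -/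

/-- The `κ` lowest binary digits. -/
def lowBits : ℕ → ℕ → List Bool
  | 0, _ => []
  | κ + 1, c => (c % 2 == 1) :: lowBits κ (c / 2)

theorem encodeNat_two_mul {n : ℕ} (hn : 0 < n) : encodeNat (2 * n) = false :: encodeNat n := by
  induction n, hn using Nat.le_induction with
  | base => rw [encodeNat_succ 1, encodeNat_one]; rfl
  | succ n _ ih =>
    rw [show 2 * (n + 1) = 2 * n + 1 + 1 by ring, encodeNat_succ, encodeNat_succ, ih,
      encodeNat_succ]
    rfl

theorem encodeNat_two_mul_add_one {n : ℕ} (hn : 0 < n) :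
    encodeNat (2 * n + 1) = true :: encodeNat n := by
  rw [encodeNat_succ, encodeNat_two_mul hn]; rfl

/-- The number `c` occupies the `κ` low bits, so a value is printed as a constant block of bits
followed by the counter. For `j = 0` the padding zeros would not form a canonical numeral, which is
why the rules avoid position 0. -/
theorem encodeNat_add_mul {κ c j : ℕ} (hj : 0 < j) (hc : c < 2 ^ κ) :
    encodeNat (c + 2 ^ κ * j) = lowBits κ c ++ encodeNat j := by
  induction κ generalizing c with
  | zero =>
    have : c = 0 := by simpa using hc
    subst this
    simp [lowBits]
  | succ κ ih =>
    rw [pow_succ] at hc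
    have h := ih (c := c / 2) (by omega)
    have h0 : 0 < c / 2 + 2 ^ κ * j := by positivity
    rcases Nat.mod_two_eq_zero_or_one c with h₁ | h₁
    · rw [show c + 2 ^ (κ + 1) * j = 2 * (c / 2 + 2 ^ κ * j) by
        rw [pow_succ, mul_add]; nth_rw 1 [← Nat.div_add_mod c 2]; rw [h₁]; ring,
        encodeNat_two_mul h0, h]
      simp [lowBits, h₁]
    · rw [show c + 2 ^ (κ + 1) * j = 2 * (c / 2 + 2 ^ κ * j) + 1 by
        rw [pow_succ, mul_add]; nth_rw 1 [← Nat.div_add_mod c 2]; rw [h₁]; ring,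
        encodeNat_two_mul_add_one h0, h]
      simp [lowBits, h₁]

/-! ### Templates and their filling -/

namespace Template

/-- A template without holes. -/
def lit (l : List Γ') : Template := l.map Sum.inl

/-- The template of a list. -/
def list {α : Type} (e : α → Template) (l : List α) : Template :=
  l.flatMap (fun x => Sum.inl Γ'.bra :: e x) ++ [Sum.inl Γ'.ket]

variable {j a : List Bool}

@[simp]
theorem fill_nil : fill j a [] = [] := rfl

@[simp]
theorem fill_append (m m' : Template) : fill j a (m ++ m') = fill j a m ++ fill j a m' := by
  simp [fill]

@[simp]
theorem fill_inl (g : Γ') (m : Template) : fill j a (Sum.inl g :: m) = g :: fill j a m := by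
  simp [fill]

@[simp]
theorem fill_false (m : Template) :
    fill j a (Sum.inr false :: m) = j.map Γ'.bit ++ fill j a m := by
  simp [fill]

@[simp]
theorem fill_true (m : Template) :
    fill j a (Sum.inr true :: m) = a.map Γ'.bit ++ fill j a m := by
  simp [fill]

@[simp]
theorem fill_lit (l : List Γ') : fill j a (lit l) = l := by
  simp [fill, lit, List.flatMap_map]

theorem fill_flatMap {α : Type} (e : α → Template) (l : List α) :
    fill j a (l.flatMap e) = l.flatMap fun x => fill j a (e x) := by
  simp [fill, List.flatMap_assoc]

theorem encList_eq {α : Type} (e : α → List Γ') (l : List α) :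
    encList e l = l.flatMap (fun x => Γ'.bra :: e x) ++ [Γ'.ket] := by
  induction l with
  | nil => rfl
  | cons x l ih => simp [encList, ih]

@[simp]
theorem fill_list {α : Type} (e : α → Template) (l : List α) :
    fill j a (list e l) = encList (fun x => fill j a (e x)) l := by
  simp [list, encList_eq, fill_flatMap]

end Template

namespace TileSys

open Template

variable {κ : ℕ}

/-- The template of the value with a given tile. -/
def valT (c : Fin (2 ^ κ)) : Template :=
  lit ((lowBits κ c).map Γ'.bit) ++ [Sum.inr false, Sum.inl Γ'.comma]

theorem fill_valT {M : ℕ} {j : Fin (M + 2)} (hj : 0 < j.val) (c : Fin (2 ^ κ)) (a : List Bool) :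
    (valT c).fill (encodeNat j) a = encNat (pack j c) := by
  have h : (pack j c).val = c + 2 ^ κ * j := rfl
  simp [valT, encNat, h, encodeNat_add_mul hj c.2]

/-- The template of the durations and the successors of the values at a position. -/
def varT (T : TileSys (2 ^ κ)) : Template :=
  (List.finRange (2 ^ κ)).flatMap fun c =>
    Sum.inl Γ'.bra :: (lit (encIntv (Intv.fromTo 1)) ++ list valT (T.next c))

/-- The template of an initial rule. -/
def iniT (c : Fin (2 ^ κ)) : Template :=
  lit (Γ'.bra :: Γ'.bit false :: Γ'.bra :: Γ'.bra :: (encNat 0 ++ encNat 0)) ++ (valT c ++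
    (lit ([Γ'.ket, Γ'.bra, Γ'.bit true] ++ (encNat 0 ++ (encEndpoint .finish ++
      encIntv (Intv.zeroTo 1)))) ++
      (Sum.inr false :: Sum.inl Γ'.comma :: lit [Γ'.ket, Γ'.ket])))

/-- The template of an existential statement of the rule of a tile. -/
def laterT (c : Fin (2 ^ κ)) : Template :=
  lit (Γ'.bra :: (encNat 1 ++ encNat 0)) ++ (valT c ++
    (lit ([Γ'.ket, Γ'.bra, Γ'.bra] ++ (encNat 0 ++ (encEndpoint .finish ++ encNat 0))) ++
      (Sum.inr true :: Sum.inl Γ'.comma ::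
        lit ([Γ'.bit true, Γ'.bit true] ++ (encEndpoint .start ++ (encNat 1 ++ [Γ'.ket]))))))

/-- The template of the rule of a tile. -/
def tileT (T : TileSys (2 ^ κ)) (c : Fin (2 ^ κ)) : Template :=
  lit (Γ'.bit true :: (encNat 0 ++ encNat 0)) ++ (valT c ++
    if T.final c then lit [Γ'.bra, Γ'.ket, Γ'.ket, Γ'.ket] else list laterT (T.later c))

/-- The data of the generation of the domain of a tile system. -/
def gen (T : TileSys (2 ^ κ)) (c k : ℕ) (first rest : Option Bool → Fin (2 ^ κ)) : Gen where
  c := c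
  k := k
  pre := lit [Γ'.bra]
  var := T.varT
  mid := lit [Γ'.ket, Γ'.ket]
  first b := iniT (first b)
  rest b := iniT (rest b)
  rule := (List.finRange (2 ^ κ)).flatMap fun c => Sum.inl Γ'.bra :: T.tileT c
  post := lit [Γ'.ket]

/-- The first tiles, for an input word. -/
def iniOf {C : ℕ} (first rest : Option Bool → Fin C) (w : List Bool) (i : ℕ) : Fin C :=
  if i = 0 then first w.head? else rest w[i]?

variable {M : ℕ} {T : TileSys (2 ^ κ)} {a : List Bool}

/-- All the successors of a value at position `j` lie at position `nextPos j`, which is therefore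
the only number to be filled in. -/
theorem fill_varT (j : Fin (M + 2)) :
    T.varT.fill (encodeNat (nextPos j)) a = (List.finRange (2 ^ κ)).flatMap fun c =>
      Γ'.bra :: (encIntv (Intv.fromTo 1) ++ encList encNat
        (((T.stateVar M).succs (pack j c)).map Fin.val)) := by
  have h : 0 < (nextPos j).val := by unfold nextPos; split_ifs <;> simp
  have hs : ∀ c : Fin (2 ^ κ), ((T.stateVar M).succs (pack j c)).map Fin.val =
      (T.next c).map fun c' => (pack (nextPos j) c').val := by
    intro c
    simp only [stateVar, pack, Equiv.symm_apply_apply, List.map_map]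
    rfl
  have he : ∀ (l : List (Fin (2 ^ κ))),
      encList encNat (l.map fun c' => (pack (nextPos j) c').val) =
        encList (fun c' => encNat (pack (nextPos j) c')) l := by
    intro l
    simp [encList_eq, List.flatMap_map]
  simp only [varT, fill_flatMap, fill_inl, fill_append, fill_lit, fill_list, fill_valT h, hs, he]

theorem fill_iniT (i : Fin (M + 1)) (c : Fin (2 ^ κ)) :
    (iniT c).fill (encodeNat (i + 1)) a = Γ'.bra :: encRule (T.iniRule M i c) := by
  have h := fill_valT (j := i.succ) (by simp) c a
  rw [Fin.val_succ] at h
  simp [iniT, iniRule, encRule, encList, encExStmt, encQuantifier, encAtom, h]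
  simp [encNat]

theorem fill_tileT (i : Fin (M + 1)) (c : Fin (2 ^ κ)) :
    (T.tileT c).fill (encodeNat (i + 1)) (encodeNat (M + 2)) = encRule (T.tileRule M i c) := by
  have h := fun c : Fin (2 ^ κ) => fill_valT (j := i.succ) (by simp) c (encodeNat (M + 2))
  simp only [Fin.val_succ] at h
  unfold tileT tileRule
  split_ifs
  · simp [encRule, encList, encExStmt, encQuantifier, h]
  · simp [encRule, encList_eq, encExStmt, encQuantifier, h, List.flatMap_map, laterT, encAtom,
      encIntv, encHi, Intv.zeroTo]
    simp [encNat]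

theorem flatMap_finRange {α : Type} (n : ℕ) (f : ℕ → List α) :
    (List.finRange n).flatMap (fun i : Fin n => f i.val) = (List.range n).flatMap f := by
  rw [← List.map_coe_finRange_eq_range, List.flatMap_map]

/-- The position is the high part of a value, so listing the values in order runs through the
positions, and through all the tiles at each of them. -/
theorem encStateVar_eq : encStateVar (T.stateVar M) =
    ((List.finRange (M + 2)).flatMap fun j => (List.finRange (2 ^ κ)).flatMap fun c =>
      Γ'.bra :: (encIntv (Intv.fromTo 1) ++ encList encNat
        (((T.stateVar M).succs (pack j c)).map Fin.val))) ++ [Γ'.ket] := by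
  have h : ∀ f : Fin ((M + 2) * 2 ^ κ) → Intv × List ℕ, List.ofFn f =
      (List.finRange (M + 2)).flatMap fun j => (List.finRange (2 ^ κ)).map fun c => f (pack j c) := by
    intro f
    rw [List.ofFn_mul, List.ofFn_eq_map, ← List.flatMap_def]
    refine List.flatMap_congr fun j _ => ?_
    rw [List.ofFn_eq_map]
    refine List.map_congr_left fun c _ => congrArg f (Fin.ext ?_)
    change j.val * 2 ^ κ + c.val = c.val + 2 ^ κ * j.val
    ring
  have h' := h fun v => ((T.stateVar M).dur v, ((T.stateVar M).succs v).map Fin.val)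
  change encList _ (List.ofFn fun v : Fin ((M + 2) * 2 ^ κ) => _) = _
  rw [h', encList_eq, List.flatMap_assoc]
  simp only [List.flatMap_map]
  rfl

/-- The next positions of `0, …, M + 1` are `1`, then `2, …, M + 1`, then `1` again: these are the
three groups of `var` blocks printed by the generator. The rules come position by position, an
initial rule followed by the rules of all the tiles. -/
theorem encDomain_eq (c k : ℕ) (first rest : Option Bool → Fin (2 ^ κ)) (w : List Bool) :
    encDomain (T.domain ((T.gen c k first rest).width w.length) (iniOf first rest w)) =
      (T.gen c k first rest).output w := by
  set M := (T.gen c k first rest).width w.length with hM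
  have h₁ : encList encStateVar (List.ofFn (T.domain M (iniOf first rest w)).var) =
      Γ'.bra :: (encStateVar (T.stateVar M) ++ [Γ'.ket]) := by
    change encList encStateVar (List.ofFn fun _ : Fin 1 => T.stateVar M) = _
    simp [encList]
  have h₂ : ∀ a, encStateVar (T.stateVar M) = T.varT.fill (encodeNat 1) [] ++
      (((List.range M).flatMap fun d => T.varT.fill (encodeNat (1 + d + 1)) []) ++
        (T.varT.fill (encodeNat 1) a ++ [Γ'.ket])) := by
    intro a
    -- This template has no hole for the window, so it does not matter that the window is already
    -- known when the last block is printed.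
    have e : ∀ b, T.varT.fill (encodeNat 1) b = T.varT.fill (encodeNat 1) [] := by
      intro b
      have := fun b => fill_varT (T := T) (a := b) (Fin.last (M + 1))
      have hl : (nextPos (Fin.last (M + 1))).val = 1 := by simp [nextPos]
      rw [hl] at this
      rw [this, this]
    have h : ∀ j : Fin (M + 2), (nextPos j).val = if j.val < M + 1 then j.val + 1 else 1 := by
      intro j; unfold nextPos; split_ifs <;> rfl
    rw [encStateVar_eq, e a]
    simp only [← fill_varT (a := []), h]
    rw [flatMap_finRange (M + 2) fun j =>
      T.varT.fill (encodeNat (if j < M + 1 then j + 1 else 1)) [], List.range_succ,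
      List.flatMap_append, List.range_succ_eq_map, List.flatMap_cons, List.flatMap_map]
    have h' : ((List.range M).flatMap fun d =>
        T.varT.fill (encodeNat (if d + 1 < M + 1 then d + 1 + 1 else 1)) []) =
        (List.range M).flatMap fun d => T.varT.fill (encodeNat (1 + d + 1)) [] :=
      List.flatMap_congr fun d hd => by
        rw [if_pos (by simpa using hd), add_comm 1 d]
    simp only [Nat.succ_eq_add_one, h']
    simp
  have h₃ : encList encRule (T.ruleList M (iniOf first rest w)) =
      (iniT (first w.head?)).fill (encodeNat 1) (encodeNat (M + 2)) ++
        ((T.gen c k first rest).rule.fill (encodeNat 1) (encodeNat (M + 2)) ++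
        (((List.range M).flatMap fun d =>
          (iniT (rest w.tail[d]?)).fill (encodeNat (1 + d + 1)) (encodeNat (M + 2)) ++
          (T.gen c k first rest).rule.fill (encodeNat (1 + d + 1)) (encodeNat (M + 2))) ++
          [Γ'.ket])) := by
    have e : ∀ i : Fin (M + 1), (T.gen c k first rest).rule.fill (encodeNat (i + 1))
        (encodeNat (M + 2)) = (List.finRange (2 ^ κ)).flatMap fun c =>
          Γ'.bra :: encRule (T.tileRule M i c) := by
      intro i
      simp only [gen, fill_flatMap, fill_inl, fill_tileT]
    rw [ruleList, encList_eq, List.flatMap_assoc]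
    simp only [List.flatMap_cons, List.flatMap_map, ← e, ← fill_iniT (a := encodeNat (M + 2))]
    rw [flatMap_finRange (M + 1) fun i => (iniT (iniOf first rest w i)).fill (encodeNat (i + 1))
      (encodeNat (M + 2)) ++ (T.gen c k first rest).rule.fill (encodeNat (i + 1))
      (encodeNat (M + 2)), List.range_succ_eq_map, List.flatMap_cons, List.flatMap_map]
    simp [iniOf, add_comm]
  have h₄ : encDomain (T.domain M (iniOf first rest w)) =
      Γ'.bra :: (encStateVar (T.stateVar M) ++ [Γ'.ket]) ++
        encList encRule (T.ruleList M (iniOf first rest w)) := by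
    rw [← h₁]; rfl
  rw [h₄, h₂ (encodeNat (M + 2)), h₃]
  simp only [Gen.output, ← hM]
  simp [gen]

end TileSys

end TP

namespace TP

/-! ## Stack machines and rows of cells -/

/-- The actions on a stack. -/
inductive Act (A : Type) where
  | keep
  | pop
  | push (a : A)

/-- The effect of an action on a stack. -/
def Act.apply {A : Type} : Act A → List A → List A
  | keep, l => l
  | pop, l => l.tail
  | push a, l => a :: l

/-- A machine with a stack for each `k : K`. In a step it looks at all the topmost symbols, and
acts on all the stacks. In the initial state it leaves the stacks unchanged. -/
structure StackMachine (Q K A : Type) where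
  trans : Q → (K → Option A) → Q × (K → Act A)
  accept : Q → (K → Option A) → Prop
  start : Q
  second : Q
  trans_start : ∀ top, trans start top = (second, fun _ => .keep)
  not_accept_start : ∀ top, ¬ accept start top

namespace StackMachine

variable {Q K A : Type} (m : StackMachine Q K A)

/-- The configurations: a state and the stacks. -/
abbrev Conf (Q K A : Type) : Type := Q × (K → List A)

/-- The topmost symbols. -/
def top (c : Conf Q K A) (k : K) : Option A := (c.2 k).head?

/-- One step of the machine. -/
def step (c : Conf Q K A) : Conf Q K A :=
  ((m.trans c.1 (top c)).1, fun k => ((m.trans c.1 (top c)).2 k).apply (c.2 k))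

/-- The configurations accepted by the machine. -/
def Accepting (c : Conf Q K A) : Prop := m.accept c.1 (top c)

/-! ### Cells and their local update -/

/-- A cell contains one symbol of each stack; the first cell contains the state too. -/
abbrev Cell (Q K A : Type) : Type := Option Q × (K → Option A)

/-- The `i`-th cell of a configuration. -/
def cell (c : Conf Q K A) (i : ℕ) : Cell Q K A :=
  (if i = 0 then some c.1 else none, fun k => (c.2 k)[i]?)

/-- The next content of the cell `s` with the neighbours `l` and `r`, when the first cell is
`g`. -/
def update (g l s r : Cell Q K A) : Cell Q K A :=
  match g.1 with
  | none => s
  | some q => (if s.1.isSome then some (m.trans q g.2).1 else none, fun k =>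
      match (m.trans q g.2).2 k with
      | .keep => s.2 k
      | .pop => if r.1.isSome then none else r.2 k
      | .push a => if s.1.isSome then some a else l.2 k)

/-- Stacks have their top in cell 0, so a push shifts the symbols right and a pop shifts them left.
The left neighbour of the first cell is never read. To the right of the last cell stands the first
cell of the next row, recognised by its state; a pop leaves nothing in the last cell, as the height
is at most `N`. -/
theorem update_cell {c : Conf Q K A} {N i : ℕ} {l r : Cell Q K A} (hc : ∀ k, (c.2 k).length ≤ N)
    (hi : i < N) (hl : 0 < i → l = cell c (i - 1)) (hr : i + 1 < N → r = cell c (i + 1))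
    (hN : i + 1 = N → r.1.isSome) :
    m.update (cell c 0) l (cell c i) r = cell (m.step c) i := by
  have htop : (fun k => (c.2 k)[0]?) = top c := by
    funext k; simp [top, List.head?_eq_getElem?]
  have h₁ : (if i = 0 then some c.1 else none : Option Q).isSome = true ↔ i = 0 := by
    split_ifs with h <;> simp [h]
  simp only [update, cell, if_true, htop, step]
  refine Prod.ext ?_ (funext fun k => ?_)
  · simp only [h₁]
  · simp only [h₁]
    cases hact : (m.trans c.1 (top c)).2 k with
    | keep => simp [Act.apply]
    | push a =>
      rcases Nat.eq_zero_or_pos i with rfl | h0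
      · simp [Act.apply]
      · obtain ⟨j, rfl⟩ : ∃ j, i = j + 1 := ⟨i - 1, by omega⟩
        simp [Act.apply, hl h0, cell]
    | pop =>
      rcases Nat.lt_or_ge (i + 1) N with h | h
      · simp [Act.apply, hr h, cell]
      · have h2 : (c.2 k).tail[i]? = none := by
          rw [List.getElem?_eq_none_iff, List.length_tail]
          have := hc k
          omega
        simp [Act.apply, hN (by omega), h2]

/-- The first cell contains the initial state. -/
def Idle (g : Cell Q K A) : Prop := g.1 = some m.start

/-- In the start state all the stacks are kept, so neither the neighbours nor the symbols of `g`
matter. This permits initial tiles with arbitrary surroundings. -/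
theorem update_idle {c : Conf Q K A} {g l r : Cell Q K A} {i : ℕ} (hg : m.Idle g)
    (hc : c.1 = m.start) : m.update g l (cell c i) r = cell (m.step c) i := by
  have h₁ : (if i = 0 then some m.start else none : Option Q).isSome = true ↔ i = 0 := by
    split_ifs with h <;> simp [h]
  unfold Idle at hg
  simp only [update, hg, m.trans_start, cell, step, hc, Act.apply, h₁]

/-- Equality, except for the symbols in the initial state. -/
def Agree (g g' : Cell Q K A) : Prop := g = g' ∨ m.Idle g ∧ m.Idle g'

variable {m}

theorem Agree.trans {g g' g'' : Cell Q K A} (h : m.Agree g g') (h' : m.Agree g' g'') :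
    m.Agree g g'' := by
  rcases h with rfl | ⟨h₁, h₂⟩
  · exact h'
  · rcases h' with rfl | ⟨h₃, h₄⟩
    · exact Or.inr ⟨h₁, h₂⟩
    · exact Or.inr ⟨h₁, h₄⟩

theorem Agree.eq {g g' : Cell Q K A} (h : m.Agree g g') (hg : ¬ m.Idle g) : g = g' :=
  h.resolve_right fun h => hg h.1

variable (m)

/-- A cell together with its neighbours and with the first cell of the row. -/
structure Tile (Q K A : Type) where
  head : Cell Q K A
  left : Cell Q K A
  self : Cell Q K A
  right : Cell Q K A

instance [Finite Q] [Finite K] [Finite A] : Finite (Tile Q K A) :=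
  Finite.of_injective (fun t => (t.head, t.left, t.self, t.right)) (by
    rintro ⟨_, _, _, _⟩ ⟨_, _, _, _⟩ h
    simpa using h)

/-- Horizontal compatibility of tiles, with a new row when a cell contains a state. -/
structure Next (t t' : Tile Q K A) : Prop where
  head_self : t'.self.1.isSome → m.Agree t'.self t'.head
  head_head : t'.self.1 = none → m.Agree t.head t'.head
  right_self : ¬ m.Idle t.head → t.right = t'.self
  self_left : ¬ m.Idle t'.head → t'.left = t.self

/-- Vertical compatibility of tiles. -/
def Later (t t' : Tile Q K A) : Prop := t'.self = m.update t.head t.left t.self t.right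

/-- The tiles of accepting configurations. -/
def Final (t : Tile Q K A) : Prop := ∃ q, t.head.1 = some q ∧ m.accept q t.head.2

/-- The tile of an initial cell. -/
def iniTile (s : Cell Q K A) : Tile Q K A := ⟨(some m.start, fun _ => none), s, s, s⟩

/-- There is a finite sequence of elements with the given beginning, in which each element that is
not final is followed, `N` places later, by an element that is allowed there. -/
def RelSolvable {τ : Type} (H V : τ → τ → Prop) (F : τ → Prop) (N : ℕ) (ini : ℕ → τ) : Prop :=
  ∃ (L : ℕ) (t : ℕ → τ), N ≤ L ∧ (∀ i < N, t i = ini i) ∧ (∀ i, i + 1 < L → H (t i) (t (i + 1))) ∧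
    ∀ i < L, F (t i) ∨ (i + N < L ∧ V (t i) (t (i + N)))

variable {m}

/-- Where `Agree` allows different symbols, the state is the start state, which never accepts. -/
theorem final_iff {c : Conf Q K A} {t : Tile Q K A} (h : m.Agree (cell c 0) t.head) :
    m.Final t ↔ m.Accepting c := by
  have htop : (fun k => (c.2 k)[0]?) = top c := by
    funext k; simp [top, List.head?_eq_getElem?]
  rcases h with h | ⟨h₁, h₂⟩
  · simp [Final, ← h, cell, Accepting, htop]
  · have hc : c.1 = m.start := by simpa [Idle, cell] using h₁
    unfold Idle at h₂
    simp [Final, h₂, Accepting, hc, m.not_accept_start]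

/-- If no configuration accepts, no tile of a row that spells a configuration is final. The row thus
forces another one, spelling the next configuration; by induction the sequence contains every row,
contrary to its finite length. -/
theorem exists_accepting_of_relSolvable {N : ℕ} (hN : 0 < N) {c : Conf Q K A}
    (hc : c.1 = m.start) (hlen : ∀ r k, ((m.step^[r] c).2 k).length ≤ N)
    (h : RelSolvable m.Next m.Later m.Final N fun i => m.iniTile (cell c i)) :
    ∃ r, m.Accepting (m.step^[r] c) := by
  by_contra! hrej
  obtain ⟨L, t, hL, hini, hnext, hlater⟩ := h
  have key : ∀ r, (r + 1) * N ≤ L ∧ (∀ i < N, (t (r * N + i)).self = cell (m.step^[r] c) i) ∧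
      m.Agree (cell (m.step^[r] c) 0) (t (r * N)).head := by
    intro r
    induction r with
    | zero =>
      refine ⟨by simpa using hL, fun i hi => ?_, Or.inr ⟨?_, ?_⟩⟩
      · rw [zero_mul, zero_add, hini i hi]; rfl
      · simp [Idle, cell, hc]
      · rw [zero_mul, hini 0 hN]; rfl
    | succ r ih =>
      obtain ⟨h₁, h₂, h₃⟩ := ih
      set d := m.step^[r] c with hd
      have hrN : (r + 1) * N = r * N + N := by ring
      have hhead : ∀ i < N, m.Agree (cell d 0) (t (r * N + i)).head := by
        intro i
        induction i with
        | zero => intro _; exact h₃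
        | succ i ih =>
          intro hi
          refine (ih (by omega)).trans ((hnext (r * N + i) (by omega)).head_head ?_)
          have := h₂ (i + 1) hi
          rw [← add_assoc] at this
          rw [this]
          simp [cell]
      have hl : ∀ i < N, r * N + i + N < L ∧ m.Later (t (r * N + i)) (t (r * N + i + N)) := by
        intro i hi
        refine (hlater _ (by omega)).resolve_left fun hf => hrej r ?_
        exact (final_iff (hhead i hi)).1 hf
      have hself : ∀ i < N, (t (r * N + i + N)).self = cell (m.step d) i := by
        -- In the start state the tiles may carry wrong neighbours, but they are not needed; in any
        -- other state `Next` makes the neighbours and the first cell correct.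
        by_cases hidle : m.Idle (cell d 0)
        · intro i hi
          have hdc : d.1 = m.start := by simpa [Idle, cell] using hidle
          rw [(hl i hi).2, h₂ i hi]
          refine m.update_idle ?_ hdc
          rcases hhead i hi with h | h
          · rwa [← h]
          · exact h.2
        · have heq : ∀ i < N, (t (r * N + i)).head = cell d 0 := fun i hi =>
            ((hhead i hi).eq hidle).symm
          -- The right neighbour of the last cell of this row is the first cell of the next row; it
          -- has to show a state, so that `update` sees the border.
          have hz : (t (r * N + N)).self.1.isSome := by
            have h0 := (hl 0 hN).2
            unfold Later at h0
            rw [h₂ 0 hN, heq 0 hN] at h0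
            simp only [add_zero] at h0
            rw [h0]
            simp [update, cell]
          intro i hi
          rw [(hl i hi).2, h₂ i hi, heq i hi]
          have hright : (t (r * N + i)).right = (t (r * N + i + 1)).self :=
            (hnext _ (by have := (hl i hi).1; omega)).right_self (by rwa [heq i hi])
          refine m.update_cell (hlen r) hi (fun h0 => ?_) (fun h1 => ?_) (fun h1 => ?_)
          · obtain ⟨j, rfl⟩ : ∃ j, i = j + 1 := ⟨i - 1, by omega⟩
            have := (hnext (r * N + j) (by have := (hl _ hi).1; omega)).self_left
              (by rw [add_assoc, heq _ hi]; exact hidle)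
            rw [← add_assoc, this, h₂ j (by omega)]
            rfl
          · rw [hright, add_assoc, h₂ _ h1]
          · rw [hright, add_assoc, h1]; exact hz
      rw [Function.iterate_succ_apply', ← hd, hrN]
      have hlast := (hl (N - 1) (by omega)).1
      refine ⟨by rw [add_mul, hrN]; omega, fun i hi => ?_, ?_⟩
      · rw [show r * N + N + i = r * N + i + N by ring, hself i hi]
      · have h0 := hself 0 hN
        rw [add_zero] at h0
        rw [← h0]
        have hp := hnext (r * N + N - 1) (by have := (hl 0 hN).1; omega)
        rw [show r * N + N - 1 + 1 = r * N + N by omega] at hp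
        refine hp.head_self ?_
        rw [h0]
        simp [cell]
  -- A sequence of length `L` has no room for `L + 1` nonempty rows.
  have h₁ := (key L).1
  have : L + 1 ≤ (L + 1) * N := Nat.le_mul_of_pos_right _ hN
  omega

/-- The rows `0, …, r₀` of the run are concatenated. Every tile is read off the run except in the
first row, where the prescribed initial tiles are used; all the tiles of the last row are final. -/
theorem relSolvable_of_accepting {N : ℕ} (hN : 0 < N) {c : Conf Q K A}
    (hc : c.1 = m.start) (hlen : ∀ r k, ((m.step^[r] c).2 k).length ≤ N) {r₀ : ℕ}
    (h : m.Accepting (m.step^[r₀] c)) :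
    RelSolvable m.Next m.Later m.Final N fun i => m.iniTile (cell c i) := by
  set s : ℕ → Cell Q K A := fun i => cell (m.step^[i / N] c) (i % N) with hs
  set t : ℕ → Tile Q K A := fun i => if i < N then m.iniTile (cell c i) else
    ⟨cell (m.step^[i / N] c) 0, s (i - 1), s i, s (i + 1)⟩ with ht
  have hself : ∀ i, (t i).self = s i := by
    intro i
    simp only [ht]
    split_ifs with hi
    · simp [iniTile, hs, Nat.div_eq_of_lt hi, Nat.mod_eq_of_lt hi]
    · rfl
  have hagree : ∀ i, m.Agree (cell (m.step^[i / N] c) 0) (t i).head := by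
    intro i
    simp only [ht]
    split_ifs with hi
    · refine Or.inr ⟨?_, rfl⟩
      simp [Nat.div_eq_of_lt hi, Idle, cell, hc]
    · exact Or.inl rfl
  have hidle : ∀ i, ¬ m.Idle (t i).head → t i =
      ⟨cell (m.step^[i / N] c) 0, s (i - 1), s i, s (i + 1)⟩ := by
    intro i hi
    by_cases h : i < N
    · refine absurd ?_ hi
      simp only [ht, if_pos h]
      rfl
    · simp only [ht, if_neg h]
  refine ⟨(r₀ + 1) * N, t, Nat.le_mul_of_pos_left _ (by omega), fun i hi => if_pos hi,
    fun i _ => ⟨fun hsome => ?_, fun hnone => ?_, fun hid => ?_, fun hid => ?_⟩, fun i hi => ?_⟩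
  · rw [hself] at hsome ⊢
    have h0 : (i + 1) % N = 0 := by
      by_contra h0
      simp [hs, cell, h0] at hsome
    simp only [hs, h0]
    exact hagree _
  · rw [hself] at hnone
    have h0 : (i + 1) % N ≠ 0 := by
      intro h0
      simp [hs, cell, h0] at hnone
    -- A cell without a state is not the first of its row, so the two places lie in the same row.
    have hdiv : (i + 1) / N = i / N := by
      rw [Nat.succ_div, if_neg, add_zero]
      rwa [Nat.dvd_iff_mod_eq_zero]
    have h₁ := hagree i
    have h₂ := hagree (i + 1)
    rw [hdiv] at h₂
    refine Agree.trans ?_ h₂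
    rcases h₁ with h₁ | h₁
    · exact Or.inl h₁.symm
    · exact Or.inr h₁.symm
  · rw [hself, hidle i hid]
  · rw [hself, hidle _ hid]
    simp
  · rcases Nat.lt_or_ge i (r₀ * N) with hlt | hge
    · right
      refine ⟨by rw [add_mul]; omega, ?_⟩
      unfold Later
      rw [hself, hself]
      have h₁ : s (i + N) = cell (m.step (m.step^[i / N] c)) (i % N) := by
        simp only [hs]
        rw [Nat.add_div_right _ hN, Nat.add_mod_right, Function.iterate_succ_apply']
      rw [h₁]
      by_cases hid : m.Idle (t i).head
      · refine (m.update_idle hid ?_).symm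
        rcases hagree i with h | h
        · rw [← h] at hid
          simpa [Idle, cell] using hid
        · simpa [Idle, cell] using h.1
      · have hmod := Nat.mod_lt i hN
        rw [hidle i hid]
        refine (m.update_cell (hlen _) hmod (fun h0 => ?_) (fun h1 => ?_) (fun h1 => ?_)).symm
        · obtain ⟨j, rfl⟩ : ∃ j, i = j + 1 := ⟨i - 1, by
            rcases i with _ | i
            · simp at h0
            · omega⟩
          have hdiv : (j + 1) / N = j / N := by
            rw [Nat.succ_div, if_neg, add_zero]
            rw [Nat.dvd_iff_mod_eq_zero]; omega
          have hm : (j + 1) % N = j % N + 1 := by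
            have e₁ := Nat.div_add_mod (j + 1) N
            have e₂ := Nat.div_add_mod j N
            rw [hdiv] at e₁
            omega
          simp only [hs, hdiv, hm, Nat.add_sub_cancel]
        · have e₂ := Nat.div_add_mod i N
          have hdm : (i + 1) / N = i / N ∧ (i + 1) % N = i % N + 1 :=
            (Nat.div_mod_unique hN).2 ⟨by omega, h1⟩
          simp only [hs, hdm]
        · have e₂ := Nat.div_add_mod i N
          have hdm : (i + 1) / N = i / N + 1 ∧ (i + 1) % N = 0 :=
            (Nat.div_mod_unique hN).2 ⟨by rw [mul_add]; omega, hN⟩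
          simp [hs, hdm, cell]
    · left
      have hdiv : i / N = r₀ := by
        refine Nat.div_eq_of_lt_le hge hi
      refine (final_iff (hagree i)).2 ?_
      rw [hdiv]
      exact h

end StackMachine

/-! ### Finite sets of tiles -/

/-- Codes of the elements of a finite type by numbers. -/
theorem exists_surjective_fin (τ : Type) [Finite τ] [Nonempty τ] :
    ∃ (κ : ℕ) (f : Fin (2 ^ κ) → τ), Function.Surjective f := by
  obtain ⟨n, ⟨e⟩⟩ := Finite.exists_equiv_fin τ
  have hn : n < 2 ^ n := Nat.lt_two_pow_self
  refine ⟨n, fun i => if h : i.val < n then e.symm ⟨i, h⟩ else Classical.arbitrary τ, fun x => ?_⟩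
  exact ⟨⟨e x, (e x).2.trans hn⟩, by simp⟩

open Classical in
/-- The tile system of a coded type with two relations and a predicate. -/
noncomputable def TileSys.ofRel {τ : Type} {C : ℕ} (f : Fin C → τ) (H V : τ → τ → Prop)
    (F : τ → Prop) : TileSys C where
  next c := (List.finRange C).filter fun c' => H (f c) (f c')
  later c := (List.finRange C).filter fun c' => V (f c) (f c')
  final c := decide (F (f c))

/-- The conditions depend on a code only through the element it denotes, so any preimages will do;
the first `N` must be the prescribed codes, which need not be the chosen ones. -/
theorem TileSys.solvable_ofRel {τ : Type} {C : ℕ} {f : Fin C → τ} (hf : Function.Surjective f)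
    {H V : τ → τ → Prop} {F : τ → Prop} {N : ℕ} {ini : ℕ → Fin C} :
    (TileSys.ofRel f H V F).Solvable N ini ↔
      StackMachine.RelSolvable H V F N fun i => f (ini i) := by
  constructor
  · rintro ⟨L, t, h₁, h₂, h₃, h₄⟩
    refine ⟨L, fun i => f (t i), h₁, fun i hi => congrArg f (h₂ i hi), fun i hi => ?_,
      fun i hi => ?_⟩
    · simpa [TileSys.ofRel] using h₃ i hi
    · simpa [TileSys.ofRel] using h₄ i hi
  · rintro ⟨L, t, h₁, h₂, h₃, h₄⟩
    choose g hg using hf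
    have ht : ∀ i, f (if i < N then ini i else g (t i)) = t i := by
      intro i
      split_ifs with hi
      · exact (h₂ i hi).symm
      · exact hg _
    refine ⟨L, fun i => if i < N then ini i else g (t i), h₁, fun i hi => if_pos hi,
      fun i hi => ?_, fun i hi => ?_⟩
    · simpa [TileSys.ofRel, ht] using h₃ i hi
    · simpa [TileSys.ofRel, ht, hg] using h₄ i hi

end TP

namespace TP

/-! ## From `Turing.TM2` to stack machines -/

namespace OfTM2

open Turing Turing.TM2 Turing.TM2.Stmt Function

variable {K : Type} {Γ : K → Type} {Λ σ : Type}

/-- The statements that occur in a program. -/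
def Occurs (M : Λ → Stmt Γ Λ σ) (q : Stmt Γ Λ σ) : Prop := ∃ l, q ∈ stmts₁ (M l)

/-- The statements that occur in a program, as a type. -/
abbrev Pos (M : Λ → Stmt Γ Λ σ) : Type := {q : Stmt Γ Λ σ // Occurs M q}

instance [Finite Λ] (M : Λ → Stmt Γ Λ σ) : Finite (Pos M) := by
  have : {q | Occurs M q} = ⋃ l, (↑(stmts₁ (M l)) : Set (Stmt Γ Λ σ)) := by
    ext q; simp [Occurs]
  have h : {q | Occurs M q}.Finite :=
    this ▸ Set.finite_iUnion fun l => (stmts₁ (M l)).finite_toSet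
  exact h.to_subtype

/-- The statement of a label. -/
def Pos.entry (M : Λ → Stmt Γ Λ σ) (l : Λ) : Pos M := ⟨M l, l, stmts₁_self⟩

variable {M : Λ → Stmt Γ Λ σ}

theorem Occurs.of_mem {q q' : Stmt Γ Λ σ} (h : Occurs M q) (h' : q' ∈ stmts₁ q) : Occurs M q' :=
  h.imp fun _ hl => stmts₁_trans hl h'

theorem Occurs.of_push {k : K} {f : σ → Γ k} {q : Stmt Γ Λ σ} (h : Occurs M (push k f q)) :
    Occurs M q := h.of_mem (by simp [stmts₁, stmts₁_self])

theorem Occurs.of_peek {k : K} {f : σ → Option (Γ k) → σ} {q : Stmt Γ Λ σ}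
    (h : Occurs M (peek k f q)) : Occurs M q := h.of_mem (by simp [stmts₁, stmts₁_self])

theorem Occurs.of_pop {k : K} {f : σ → Option (Γ k) → σ} {q : Stmt Γ Λ σ}
    (h : Occurs M (pop k f q)) : Occurs M q := h.of_mem (by simp [stmts₁, stmts₁_self])

theorem Occurs.of_load {f : σ → σ} {q : Stmt Γ Λ σ}
    (h : Occurs M (load f q)) : Occurs M q := h.of_mem (by simp [stmts₁, stmts₁_self])

theorem Occurs.of_branch {f : σ → Bool} {q₁ q₂ : Stmt Γ Λ σ} (h : Occurs M (branch f q₁ q₂)) :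
    Occurs M q₁ ∧ Occurs M q₂ :=
  ⟨h.of_mem (by simp [stmts₁, stmts₁_self]), h.of_mem (by simp [stmts₁, stmts₁_self])⟩

variable (M) (k₀ : K)

/-- Symbols: the result of a push statement in a given internal state, or an input symbol. -/
abbrev Sym : Type := (Pos M × σ) ⊕ Γ k₀

/-- Control states: the initial state, or a statement to be executed, if any, with an internal
state. -/
abbrev Ctl : Type := Option (Option (Pos M) × σ)

variable {M k₀}

section

variable (m : StackMachine (Ctl M) K (Sym M k₀))

/-- A nonempty run between `c` and `c'` that stays in running states and below the height `B`. -/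
def RunsTo (B : ℕ) (c c' : StackMachine.Conf (Ctl M) K (Sym M k₀)) : Prop :=
  ∃ n, m.step^[n] c = c' ∧ (∀ r < n, ∀ v, (m.step^[r] c).1 ≠ some (none, v)) ∧
    ∀ r < n, ∀ k, ((m.step^[r] c).2 k).length ≤ B

variable {m} {B : ℕ} {c c' c'' : StackMachine.Conf (Ctl M) K (Sym M k₀)}

theorem RunsTo.refl : RunsTo m B c c := ⟨0, rfl, by simp, by simp⟩

theorem RunsTo.head (h₁ : ∀ v, c.1 ≠ some (none, v)) (h₂ : ∀ k, (c.2 k).length ≤ B)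
    (h : RunsTo m B (m.step c) c') : RunsTo m B c c' := by
  obtain ⟨n, h₃, h₄, h₅⟩ := h
  refine ⟨n + 1, h₃, fun r hr => ?_, fun r hr => ?_⟩
  · cases r with
    | zero => exact h₁
    | succ r => exact h₄ r (by omega)
  · cases r with
    | zero => exact h₂
    | succ r => exact h₅ r (by omega)

theorem RunsTo.trans (h : RunsTo m B c c') (h' : RunsTo m B c' c'') : RunsTo m B c c'' := by
  obtain ⟨n, h₃, h₄, h₅⟩ := h
  induction n generalizing c with
  | zero => exact (show c = c' from h₃) ▸ h'
  | succ n ih =>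
    exact .head (h₄ 0 n.succ_pos) (h₅ 0 n.succ_pos) (ih h₃ (fun r hr => h₄ (r + 1) (by omega))
      fun r hr => h₅ (r + 1) (by omega))

end

variable [DecidableEq K]

/-- The symbol of the `k`-th stack denoted by a code. -/
def dec (k : K) : Sym M k₀ → Option (Γ k)
  | .inl (⟨push k' f _, _⟩, v) => if h : k' = k then some (h ▸ f v) else none
  | .inl _ => none
  | .inr a => if h : k₀ = k then some (h ▸ a) else none

/-- Execution of one instruction. -/
def instr (v : σ) (top : K → Option (Sym M k₀)) : Pos M → Ctl M × (K → Act (Sym M k₀))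
  | ⟨push k f q, h⟩ => (some (some ⟨q, h.of_push⟩, v), fun k' =>
      if k' = k then .push (.inl (⟨push k f q, h⟩, v)) else .keep)
  | ⟨peek k f q, h⟩ =>
      (some (some ⟨q, h.of_peek⟩, f v ((top k).bind (dec k))), fun _ => .keep)
  | ⟨pop k f q, h⟩ => (some (some ⟨q, h.of_pop⟩, f v ((top k).bind (dec k))), fun k' =>
      if k' = k then .pop else .keep)
  | ⟨load f q, h⟩ => (some (some ⟨q, h.of_load⟩, f v), fun _ => .keep)
  | ⟨branch f q₁ q₂, h⟩ => (some (some (bif f v then ⟨q₁, h.of_branch.1⟩ else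
      ⟨q₂, h.of_branch.2⟩), v), fun _ => .keep)
  | ⟨goto l, _⟩ => (some (some (Pos.entry M (l v)), v), fun _ => .keep)
  | ⟨halt, _⟩ => (some (none, v), fun _ => .keep)

variable (M k₀) in
/-- The stack machine of a program; it accepts when the program has halted with `a` on top of the
stack `k₁`. -/
def machine (main : Λ) (v₀ : σ) (k₁ : K) (a : Γ k₁) : StackMachine (Ctl M) K (Sym M k₀) where
  trans
    | none, _ => (some (some (Pos.entry M main), v₀), fun _ => .keep)
    | some (none, v), _ => (some (none, v), fun _ => .keep)
    | some (some q, v), top => instr v top q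
  accept
    | some (none, _), top => (top k₁).bind (dec k₁) = some a
    | _, _ => False
  start := none
  second := some (some (Pos.entry M main), v₀)
  trans_start _ := rfl
  not_accept_start _ := id

/-- The stacks `s` are codes of the stacks `S`. -/
def Codes (s : K → List (Sym M k₀)) (S : ∀ k, List (Γ k)) : Prop :=
  ∀ k, (s k).map (dec k) = (S k).map some

theorem Codes.length {s : K → List (Sym M k₀)} {S : ∀ k, List (Γ k)} (h : Codes s S) (k : K) :
    (s k).length = (S k).length := by
  simpa using congrArg List.length (h k)

theorem Codes.le {s : K → List (Sym M k₀)} {S : ∀ k, List (Γ k)} (h : Codes s S) {B D : ℕ}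
    (hB : ∀ k, (S k).length + D ≤ B) (k : K) : (s k).length ≤ B := by
  have := hB k
  rw [h.length]
  omega

theorem Codes.head? {s : K → List (Sym M k₀)} {S : ∀ k, List (Γ k)} (h : Codes s S) (k : K) :
    (s k).head?.bind (dec k) = (S k).head? := by
  have := congrArg List.head? (h k)
  cases hs : s k <;> cases hS : S k <;> simp_all

theorem Codes.push {s : K → List (Sym M k₀)} {S : ∀ k, List (Γ k)} (h : Codes s S) {k : K}
    {f : σ → Γ k} {q : Stmt Γ Λ σ} (hq : Occurs M (push k f q)) (v : σ) :
    Codes (fun k' => (if k' = k then Act.push (.inl (⟨_, hq⟩, v)) else Act.keep).apply (s k'))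
      (update S k (f v :: S k)) := by
  intro k'
  by_cases hk : k' = k
  · subst hk
    simp [Act.apply, dec, h k']
  · simp [hk, Act.apply, h k']

theorem Codes.pop {s : K → List (Sym M k₀)} {S : ∀ k, List (Γ k)} (h : Codes s S) (k : K) :
    Codes (fun k' => (if k' = k then Act.pop else Act.keep).apply (s k'))
      (update S k (S k).tail) := by
  intro k'
  by_cases hk : k' = k
  · subst hk
    simp [Act.apply, h k']
  · simp [hk, Act.apply, h k']

/-- The number of nested push statements. -/
def pushes : Stmt Γ Λ σ → ℕ
  | push _ _ q => pushes q + 1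
  | peek _ _ q | pop _ _ q | load _ q => pushes q
  | branch _ q₁ q₂ => max (pushes q₁) (pushes q₂)
  | goto _ | halt => 0

variable {main : Λ} {v₀ : σ} {k₁ : K} {a : Γ k₁}

/-- One step of `TM2` executes a whole statement, and the stack machine does so one instruction at a
time. In between a stack can exceed its initial height by at most the number of nested pushes. -/
theorem runsTo_stepAux {B : ℕ} (q : Stmt Γ Λ σ) (hq : Occurs M q) (v : σ)
    {S : ∀ k, List (Γ k)} {s : K → List (Sym M k₀)} (h : Codes s S)
    (hB : ∀ k, (S k).length + pushes q ≤ B) :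
    ∃ s', RunsTo (machine M k₀ main v₀ k₁ a) B (some (some ⟨q, hq⟩, v), s)
      (some ((stepAux q v S).l.map (Pos.entry M), (stepAux q v S).var), s') ∧
      Codes s' (stepAux q v S).stk := by
  induction q generalizing v S s with
  | push k f q ih =>
    obtain ⟨s', h₁, h₂⟩ := ih hq.of_push v (h.push hq v) (fun k' => by
      have := hB k'
      simp only [pushes] at this
      by_cases hk : k' = k
      · subst hk
        simp only [update_self, List.length_cons]
        omega
      · simp only [update_of_ne hk]
        omega)
    exact ⟨s', .head (by simp) (h.le hB) h₁, h₂⟩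
  | peek k f q ih =>
    obtain ⟨s', h₁, h₂⟩ := ih hq.of_peek (f v ((s k).head?.bind (dec k))) h hB
    simp only [stepAux, ← h.head?]
    exact ⟨s', .head (by simp) (h.le hB) h₁, h₂⟩
  | pop k f q ih =>
    obtain ⟨s', h₁, h₂⟩ := ih hq.of_pop (f v ((s k).head?.bind (dec k))) (h.pop k) (fun k' => by
      have := hB k'
      simp only [pushes] at this
      by_cases hk : k' = k
      · subst hk
        simp only [update_self, List.length_tail]
        omega
      · simp only [update_of_ne hk]
        omega)
    simp only [stepAux, ← h.head?]
    exact ⟨s', .head (by simp) (h.le hB) h₁, h₂⟩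
  | load f q ih =>
    obtain ⟨s', h₁, h₂⟩ := ih hq.of_load (f v) h hB
    exact ⟨s', .head (by simp) (h.le hB) h₁, h₂⟩
  | branch f q₁ q₂ ih₁ ih₂ =>
    simp only [pushes] at hB
    cases hf : f v with
    | true =>
      obtain ⟨s', h₁, h₂⟩ := ih₁ hq.of_branch.1 v h fun k => by have := hB k; omega
      simp only [stepAux, hf, cond_true]
      refine ⟨s', .head (by simp) (h.le hB) ?_, h₂⟩
      simpa [StackMachine.step, machine, instr, hf, Act.apply] using h₁
    | false =>
      obtain ⟨s', h₁, h₂⟩ := ih₂ hq.of_branch.2 v h fun k => by have := hB k; omega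
      simp only [stepAux, hf, cond_false]
      refine ⟨s', .head (by simp) (h.le hB) ?_, h₂⟩
      simpa [StackMachine.step, machine, instr, hf, Act.apply] using h₁
  | goto l => exact ⟨s, .head (by simp) (h.le hB) .refl, h⟩
  | halt => exact ⟨s, .head (by simp) (h.le hB) .refl, h⟩

/-- The bound `B` is known only for configurations between two steps of `TM2`; the summand `D`
covers the intermediate ones. -/
theorem runsTo_of_iterate {B D : ℕ} (hD : ∀ l, pushes (M l) ≤ D) {c c' : Cfg Γ Λ σ} {n : ℕ}
    (hn : (flip bind (TM2.step M))^[n] (some c) = some c')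
    (hB : ∀ d, StateTransition.Reaches (TM2.step M) c d → ∀ k, (d.stk k).length ≤ B)
    {s : K → List (Sym M k₀)} (h : Codes s c.stk) :
    ∃ s', RunsTo (machine M k₀ main v₀ k₁ a) (B + D) (some (c.l.map (Pos.entry M), c.var), s)
      (some (c'.l.map (Pos.entry M), c'.var), s') ∧ Codes s' c'.stk ∧
      ∀ k, (c'.stk k).length ≤ B := by
  induction n generalizing c s with
  | zero =>
    obtain rfl : c = c' := Option.some.inj hn
    exact ⟨s, .refl, h, hB _ .refl⟩
  | succ n ih =>
    rw [iterate_succ_apply] at hn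
    obtain ⟨_ | l, v, S⟩ := c
    · have : ∀ n, (flip bind (TM2.step M))^[n] none = none := fun n => by
        induction n with
        | zero => rfl
        | succ n ih => rw [iterate_succ_apply]; exact ih
      exact absurd (hn.symm.trans (this n)) (by simp)
    · have hs : TM2.step M ⟨some l, v, S⟩ = some (stepAux (M l) v S) := rfl
      obtain ⟨s₁, h₁, h₂⟩ := runsTo_stepAux (B := B + D) (main := main) (v₀ := v₀) (k₁ := k₁)
        (a := a) (M l) (Pos.entry M l).2 v h
        fun k => Nat.add_le_add (hB _ Relation.ReflTransGen.refl k) (hD l)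
      obtain ⟨s₂, h₃, h₄, h₅⟩ := ih hn (fun d hd => hB d (hd.head hs)) h₂
      exact ⟨s₂, h₁.trans h₃, h₄, h₅⟩

/-- A program that halts, started with the codes `s` on the stacks of its stack machine. -/
theorem exists_accepting_iff {B D : ℕ} (hD : ∀ l, pushes (M l) ≤ D) {S : ∀ k, List (Γ k)}
    {c : Cfg Γ Λ σ} {n : ℕ}
    (hn : (flip bind (TM2.step M))^[n] (some ⟨some main, v₀, S⟩) = some c) (hc : c.l = none)
    (hB : ∀ d, StateTransition.Reaches (TM2.step M) ⟨some main, v₀, S⟩ d →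
      ∀ k, (d.stk k).length ≤ B)
    {s : K → List (Sym M k₀)} (h : Codes s S) :
    ((∃ r, (machine M k₀ main v₀ k₁ a).Accepting
        ((machine M k₀ main v₀ k₁ a).step^[r] (none, s))) ↔ (c.stk k₁).head? = some a) ∧
      ∀ r k, (((machine M k₀ main v₀ k₁ a).step^[r] (none, s)).2 k).length ≤ B + D := by
  obtain ⟨s', h₁, h₂, h₃⟩ := runsTo_of_iterate (main := main) (v₀ := v₀) (k₁ := k₁) (a := a) hD hn
    hB h
  rw [hc] at h₁
  have hB₀ : ∀ k, (s k).length ≤ B + D := fun k => by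
    have := hB _ Relation.ReflTransGen.refl k
    rw [h.length]
    exact this.trans (Nat.le_add_right _ _)
  have hB₁ : ∀ k, (s' k).length ≤ B + D := fun k => by
    rw [h₂.length]
    exact (h₃ k).trans (Nat.le_add_right _ _)
  obtain ⟨N, h₃, h₄, h₅⟩ : RunsTo (machine M k₀ main v₀ k₁ a) (B + D) (none, s) _ :=
    .head (by simp) hB₀ h₁
  -- A halted control state is a fixed point, and before time `N` no state is halted; so acceptance
  -- is decided by the final stacks alone.
  have hfix : ∀ r, N ≤ r → (machine M k₀ main v₀ k₁ a).step^[r] (none, s) =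
      (some (none, c.var), s') := by
    intro r hr
    induction r, hr using Nat.le_induction with
    | base => exact h₃
    | succ r _ ih => rw [iterate_succ_apply', ih]; rfl
  refine ⟨⟨?_, fun hr => ⟨N, ?_⟩⟩, fun r k => ?_⟩
  · rintro ⟨r, hr⟩
    rcases Nat.lt_or_ge r N with hN | hN
    · have := h₄ r hN
      generalize (machine M k₀ main v₀ k₁ a).step^[r] (none, s) = d at hr this
      obtain ⟨_ | ⟨_ | q, v⟩, t⟩ := d
      · exact hr.elim
      · exact absurd rfl (this v)
      · exact hr.elim
    · rw [hfix r hN] at hr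
      exact (h₂.head? k₁).symm.trans hr
  · rw [h₃]
    exact (h₂.head? k₁).trans hr
  · rcases Nat.lt_or_ge r N with hN | hN
    · exact h₅ r hN k
    · rw [hfix r hN]
      exact hB₁ k

end OfTM2

end TP

/-! ### The reduction from an arbitrary language in PSPACE -/

namespace TP

open Turing

/-- The initial stacks. -/
def OfTM2.input (M : TM2ComputableAux Bool Bool) (w : List Bool) (k : M.tm.K) :
    List (OfTM2.Sym M.tm.m M.tm.k₀) :=
  if k = M.tm.k₀ then w.map fun b => .inr (M.inputAlphabet.symm b) else []

theorem OfTM2.codes_input (M : TM2ComputableAux Bool Bool) (w : List Bool) :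
    OfTM2.Codes (OfTM2.input M w) (initList M.tm (w.map M.inputAlphabet.symm)).stk := by
  intro k
  by_cases hk : k = M.tm.k₀
  · subst hk
    simp [OfTM2.input, initList, OfTM2.dec]
  · simp [OfTM2.input, initList, hk]

open Classical in
/-- A language in PSPACE is accepted by a stack machine whose stacks have polynomial height. -/
theorem InPSPACE.exists_stackMachine {L : Set (List Bool)} (hL : InPSPACE L) :
    ∃ (Q K A : Type) (_ : Finite Q) (_ : Finite K) (_ : Finite A) (m : StackMachine Q K A)
      (s : K → Bool → Option A) (p : Polynomial ℕ), ∀ w : List Bool,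
      ∃ c : StackMachine.Conf Q K A, c.1 = m.start ∧
        (∀ (k : K) (i : ℕ), (c.2 k)[i]? = w[i]?.bind (s k)) ∧ w.length ≤ p.eval w.length ∧
        (∀ r k, ((m.step^[r] c).2 k).length ≤ p.eval w.length) ∧
        (w ∈ L ↔ ∃ r, m.Accepting (m.step^[r] c)) := by
  obtain ⟨M, p, h⟩ := hL
  let _ := M.tm.kFin
  let _ := M.tm.ΛFin
  let _ := M.tm.σFin
  -- Only the alphabet of the input stack is assumed finite. Any other symbol comes from a push, and
  -- `Sym` encodes it by the statement and the internal state that produced it.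
  let _ := M.tm.Γk₀Fin
  set D := Finset.univ.sup fun l => OfTM2.pushes (M.tm.m l)
  have hD : ∀ l, OfTM2.pushes (M.tm.m l) ≤ D := fun l =>
    Finset.le_sup (f := fun l => OfTM2.pushes (M.tm.m l)) (Finset.mem_univ l)
  refine ⟨_, _, _, inferInstance, inferInstance, inferInstance,
    OfTM2.machine M.tm.m M.tm.k₀ M.tm.main M.tm.initialState M.tm.k₁
      (M.outputAlphabet.symm true),
    fun k b => if k = M.tm.k₀ then some (.inr (M.inputAlphabet.symm b)) else none,
    p + Polynomial.C D, fun w => ⟨(none, OfTM2.input M w), rfl, fun k i => ?_, ?_⟩⟩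
  · by_cases hk : k = M.tm.k₀
    · simp [OfTM2.input, hk, Option.map_eq_bind]
    · simp [OfTM2.input, hk]
  · obtain ⟨hB, ⟨⟨n, hn⟩⟩⟩ := h w
    have hB' : ∀ d, StateTransition.Reaches (TM2.step M.tm.m)
        (initList M.tm (w.map M.inputAlphabet.symm)) d →
        ∀ k, (d.stk k).length ≤ p.eval w.length := fun d hd k =>
      le_trans (Finset.single_le_sum (f := fun k => (d.stk k).length)
        (fun _ _ => Nat.zero_le _) (Finset.mem_univ k)) (hB d hd)
    have key := OfTM2.exists_accepting_iff (a := M.outputAlphabet.symm true) hD hn rfl hB'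
      (OfTM2.codes_input M w)
    simp only [Polynomial.eval_add, Polynomial.eval_C]
    refine ⟨?_, key.2, ?_⟩
    · refine le_trans ?_ (Nat.le_add_right _ _)
      simpa [initList] using hB' _ .refl M.tm.k₀
    -- The output is one bit, so the top of the output stack is the code of `true` exactly for the
    -- words of the language.
    · rw [key.1]
      simp [haltList]

theorem exists_polynomial_bound (p : Polynomial ℕ) :
    ∃ c k : ℕ, ∀ n, p.eval n ≤ c * (n + 1) ^ k := by
  induction p using Polynomial.induction_on' with
  | add p q hp hq =>
    obtain ⟨c, k, h⟩ := hp
    obtain ⟨c', k', h'⟩ := hq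
    refine ⟨c + c', max k k', fun n => ?_⟩
    rw [Polynomial.eval_add, add_mul]
    exact add_le_add
      ((h n).trans (Nat.mul_le_mul_left _ (Nat.pow_le_pow_right n.succ_pos (le_max_left _ _))))
      ((h' n).trans (Nat.mul_le_mul_left _ (Nat.pow_le_pow_right n.succ_pos (le_max_right _ _))))
  | monomial k a =>
    exact ⟨a, k, fun n => by
      rw [Polynomial.eval_monomial]
      exact Nat.mul_le_mul_left _ (Nat.pow_le_pow_left n.le_succ _)⟩

theorem PSPACEHard.mono {α Γ : Type} [Fintype Γ] {enc : Computability.Encoding α Γ}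
    {inst inst' yes : Set α} (h : PSPACEHard enc inst yes) (hi : inst ⊆ inst') :
    PSPACEHard enc inst' yes := fun L hL =>
  let ⟨f, h₁, h₂, h₃⟩ := h L hL
  ⟨f, h₁, fun w => hi (h₂ w), h₃⟩

/-- The stack machine of the language gives a finite set of tiles, coded by `κ` bits. The period is
one more than a bound `(c + 2) * (n + 1) ^ k` for the heights, and an initial tile depends only on
the input bit at its place and on whether that place is the first. -/
theorem pspaceHard_oneVar : PSPACEHard domainEncoding
    {P | P.numVars = 1 ∧ P.IsSimple ∧ P.AtomsZeroTo ∧ P.DurationsZeroToOrFrom}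
    {P | P.HasFuturePlan} := by
  intro L hL
  obtain ⟨Q, K, A, _, _, _, m, s, p, h⟩ := InPSPACE.exists_stackMachine hL
  obtain ⟨c, k, hp⟩ := exists_polynomial_bound p
  have : Nonempty (StackMachine.Tile Q K A) := ⟨m.iniTile (none, fun _ => none)⟩
  obtain ⟨κ, g, hg⟩ := exists_surjective_fin (StackMachine.Tile Q K A)
  obtain ⟨g', hg'⟩ := hg.hasRightInverse
  set T := TileSys.ofRel g m.Next m.Later m.Final
  set first : Option Bool → Fin (2 ^ κ) := fun b =>
    g' (m.iniTile (some m.start, fun k => b.bind (s k)))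
  set rest : Option Bool → Fin (2 ^ κ) := fun b => g' (m.iniTile (none, fun k => b.bind (s k)))
  -- The additional 2 makes the width at least 2, as `hasFuturePlan_domain_iff` requires.
  set G := T.gen (c + 2) k first rest
  have hw : ∀ n, p.eval n ≤ G.width n ∧ 2 ≤ G.width n := fun n => by
    have h₁ : 1 ≤ (n + 1) ^ k := Nat.one_le_pow _ _ n.succ_pos
    have h₂ : G.width n = c * (n + 1) ^ k + 2 * (n + 1) ^ k := by
      rw [← add_mul]; rfl
    have := hp n
    omega
  refine ⟨fun w => T.domain (G.width w.length) (TileSys.iniOf first rest w),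
    G.computable _ _ (fun n => ?_) (fun w => TileSys.encDomain_eq _ _ _ _ w), fun w =>
    ⟨rfl, T.isSimple_domain _ _, T.atomsZeroTo_domain _ _, T.durations_domain _ _⟩, fun w => ?_⟩
  -- That `n` is at most `p(n)` is known only through words, so some word of length `n` is needed.
  · obtain ⟨_, _, _, h₁, _⟩ := h (List.replicate n true)
    rw [List.length_replicate] at h₁
    have := hw n
    omega
  · obtain ⟨d, hd, hcell, -, hlen, hacc⟩ := h w
    have hini : (fun i => g (TileSys.iniOf first rest w i)) =
        fun i => m.iniTile (StackMachine.cell d i) := by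
      funext i
      rcases Nat.eq_zero_or_pos i with rfl | hi
      · simp [TileSys.iniOf, first, hg' _, StackMachine.cell, hd, hcell,
          List.head?_eq_getElem?]
      · simp [TileSys.iniOf, rest, hg' _, StackMachine.cell, hcell, hi.ne']
    have hlen' : ∀ r k, ((m.step^[r] d).2 k).length ≤ G.width w.length + 1 := fun r k =>
      ((hlen r k).trans (hw _).1).trans (Nat.le_succ _)
    rw [Set.mem_ofPred_eq, TileSys.hasFuturePlan_domain_iff (hw _).2, TileSys.solvable_ofRel hg,
      hini, hacc]
    exact ⟨fun ⟨_, hr⟩ => StackMachine.relSolvable_of_accepting (Nat.succ_pos _) hd hlen' hr,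
      StackMachine.exists_accepting_of_relSolvable (Nat.succ_pos _) hd hlen'⟩

end TP

/-- Future TP with simple trigger rules is PSPACE-hard when all the atoms of the rules have
intervals `[0, a]` with `a ≥ 1` (and token durations are constrained only by intervals `[0, a]` or
`[b, +∞[`), and this already holds with a single state variable; in particular it is PSPACE-hard
when the intervals of the trigger rules are unbounded or left-closed with left endpoint `0`. -/
theorem mainTheorem4 :
    TP.PSPACEHard TP.domainEncoding
      {P | P.IsSimple ∧ P.AtomsZeroTo ∧ P.DurationsZeroToOrFrom}
      {P | P.HasFuturePlan} ∧
    TP.PSPACEHard TP.domainEncoding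
      {P | P.numVars = 1 ∧ P.IsSimple ∧ P.AtomsZeroTo ∧ P.DurationsZeroToOrFrom}
      {P | P.HasFuturePlan} ∧
    TP.PSPACEHard TP.domainEncoding
      {P | P.IsSimple ∧ P.TriggerAtomsZeroInfty}
      {P | P.HasFuturePlan} := by
  refine ⟨TP.pspaceHard_oneVar.mono fun _ h => h.2, TP.pspaceHard_oneVar,
    TP.pspaceHard_oneVar.mono fun P h => ⟨h.2.1, fun R hR _ E hE a ha => ?_⟩⟩
  obtain ⟨n, -, hn⟩ := h.2.2.1 R hR E hE a ha
  exact Or.inr ⟨by rw [hn]; rfl, by rw [hn]; rfl⟩
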